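/- **Model.** Two identical items are sold by VCG to $n$ single-minded bidders. A type or bid is a pair $(g,\theta)$ with demand $g\in\{1,2\}$ and per-item value $\theta$; a bidder of type $(g,\theta)$ who wins $j$ items and pays $p$ in total has utility $g\theta-p$ if $j\ge g$ and $-p$ otherwise. Given bids $B=((g_i,\theta_i))_i$, VCG serves a set $W(B)$ of bids of maximal social welfare $SW(B)=\max\{\sum_{i\in I}g_i\theta_i:\sum_{i\in I}g_i\le 2\}$ (ties are broken by an arbitrary measurable rule); a winning bid $b$ pays $SW(B\setminus b)-(SW(B)-g_b\theta_b)$ and a losing bid pays $0$. A bidder may submit several bids under different identities; she then receives all items won by her bids and pays the sum of their prices. Fix one bidder of type $(g,\theta)$. The other $n-1$ bidders bid truthfully; their types are independent, each having demand $1$ with probability $q$ and demand $2$ with probability $1-q$, and an independent per-item value with distribution $F=\mathrm{UNI}([0,1])$. Let $E^{q,n}_{(g,\theta),\mathrm{truth}}$ and $E^{q,n}_{(g,\theta),\mathrm{attack}(x,y)}$ be the expected utilities of the fixed bidder when she submits $(g,\theta)$, respectively the two bids $(1,x),(1,y)$. The granularity threshold is $$q^*_{n,g,\theta,x,y}=\min\bigl\{\bar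 q\in[0,1]:\ \forall q\in(\bar q,1],\ E^{q,n}_{(g,\theta),\mathrm{truth}}\ge E^{q,n}_{(g,\theta),\mathrm{attack}(x,y)}\bigr\},$$ and $q^*_{n,g}$ is defined in the same way with the inequality required for all $\theta,x,y\in[0,1]$ simultaneously. **Theorem.** For every $n\ge 3$: 1. $q^*_{n,g=1}\le\frac12$. 2. For the split attack $x=y=\theta$ of a bidder with demand $2$, $q^*_{n,g=2,\theta,x=\theta,y=\theta}\le\frac12$ for every $\theta\in[0,1]$, and this is tight: $q^*_{n,g=2,\theta=1,x=1,y=1}=\frac12$. -/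

import Mathlib

open MeasureTheory

namespace VCGAuction

/-- The number of items a single-minded bidder demands. -/
inductive Demand where
  | one
  | two
  deriving DecidableEq

/-- The demand as a number of items. -/
def Demand.size : Demand → ℕ
  | .one => 1
  | .two => 2

instance : MeasurableSpace Demand := ⊤

/-- A type (or a bid): the demand `g` together with the per-item value. -/
abbrev Bid := Demand × ℝ

/-- What the bid is worth when its demand is met: `g` times the per-item value. -/
def Bid.total (b : Bid) : ℝ := (b.1.size : ℝ) * b.2

section Mechanism

variable {N : ℕ}

/-- The bids in `I` can be served together: they demand at most the two available items. -/
def Feasible (B : Fin N → Bid) (I : Finset (Fin N)) : Prop :=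
  ∑ i ∈ I, (B i).1.size ≤ 2

instance (B : Fin N → Bid) : DecidablePred (Feasible B) :=
  fun I => inferInstanceAs (Decidable (∑ i ∈ I, (B i).1.size ≤ 2))

/-- The (declared) welfare of serving exactly the bids in `I`. -/
def welfare (B : Fin N → Bid) (I : Finset (Fin N)) : ℝ := ∑ i ∈ I, Bid.total (B i)

/-- The maximal social welfare when only the bids in `A` take part. -/
noncomputable def maxWelfare (B : Fin N → Bid) (A : Finset (Fin N)) : ℝ :=
  (A.powerset.filter (Feasible B)).sup' ⟨∅, by simp [Feasible]⟩ (welfare B)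

end Mechanism

/-- A version of the VCG mechanism for two identical items: a choice, for each profile of bids, of
a winning set of maximal social welfare. Different versions differ only in how they break ties. -/
structure VCG where
  winners : {N : ℕ} → (Fin N → Bid) → Finset (Fin N)
  feasible : ∀ {N : ℕ} (B : Fin N → Bid), Feasible B (winners B)
  optimal : ∀ {N : ℕ} (B : Fin N → Bid), welfare B (winners B) = maxWelfare B Finset.univ
  /-- The winning set depends on the bids in a measurable way. -/
  measurable_winners : ∀ {N : ℕ} (I : Finset (Fin N)),
    MeasurableSet {B : Fin N → Bid | winners B = I}

theorem maxWelfare_univ_iff {N : ℕ} (B : Fin N → Bid) (I : Finset (Fin N)) (hI : Feasible B I) :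
    welfare B I = maxWelfare B Finset.univ ↔ ∀ J, Feasible B J → welfare B J ≤ welfare B I := by
  constructor
  · intro h J hJ
    rw [h]
    exact Finset.le_sup' (welfare B) (by simpa using hJ)
  · intro h
    apply le_antisymm
    · exact Finset.le_sup' (welfare B) (by simpa using hI)
    · apply Finset.sup'_le
      intro J hJ
      exact h J (by simpa using hJ)

theorem measurable_size (N : ℕ) (i : Fin N) : Measurable fun B : Fin N → Bid => (B i).1.size :=
  (measurable_from_top (f := Demand.size)).comp (measurable_fst.comp (measurable_pi_apply i))

theorem measurable_welfare {N : ℕ} (I : Finset (Fin N)) :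
    Measurable fun B : Fin N → Bid => welfare B I := by
  refine Finset.measurable_fun_sum _ fun i _ => ?_
  exact ((measurable_from_top (f := fun d : Demand => (d.size : ℝ))).comp
    (measurable_fst.comp (measurable_pi_apply i))).mul
      (measurable_snd.comp (measurable_pi_apply i))

theorem measurableSet_feasible {N : ℕ} (I : Finset (Fin N)) :
    MeasurableSet {B : Fin N → Bid | Feasible B I} :=
  measurableSet_le (Finset.measurable_fun_sum _ fun i _ => measurable_size N i) measurable_const

/-- `I` is a feasible set of maximal welfare. -/
def Opt {N : ℕ} (B : Fin N → Bid) (I : Finset (Fin N)) : Prop :=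
  Feasible B I ∧ ∀ J, Feasible B J → welfare B J ≤ welfare B I

theorem measurableSet_opt {N : ℕ} (I : Finset (Fin N)) :
    MeasurableSet {B : Fin N → Bid | Opt B I} := by
  refine (measurableSet_feasible I).inter ?_
  change MeasurableSet {B : Fin N → Bid | ∀ J, Feasible B J → welfare B J ≤ welfare B I}
  simp only [Set.ofPred_forall]
  refine MeasurableSet.iInter fun J => ?_
  have : {B : Fin N → Bid | Feasible B J → welfare B J ≤ welfare B I} =
      {B | Feasible B J}ᶜ ∪ {B | welfare B J ≤ welfare B I} := by
    ext B; simp [imp_iff_not_or]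
  exact this ▸ (measurableSet_feasible J).compl.union
    (measurableSet_le (measurable_welfare J) (measurable_welfare I))

theorem exists_first_opt {N : ℕ} (B : Fin N → Bid) :
    ∃ I, Opt B I ∧ ∀ J, Opt B J → Fintype.equivFin _ I ≤ Fintype.equivFin _ J := by
  classical
  have hne : (Finset.univ.filter (Opt B)).Nonempty := by
    obtain ⟨I, hI, hmax⟩ := (Finset.univ.filter (Feasible B)).exists_max_image (welfare B)
      ⟨∅, by simp [Feasible]⟩
    exact ⟨I, by simpa [Opt] using ⟨by simpa using hI, fun J hJ => hmax J (by simpa using hJ)⟩⟩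
  obtain ⟨I, hI, hmin⟩ := (Finset.univ.filter (Opt B)).exists_min_image (Fintype.equivFin _) hne
  exact ⟨I, by simpa using hI, fun J hJ => hmin J (by simpa using hJ)⟩

/-- Versions of the mechanism exist: break ties by a fixed enumeration of the sets of bids. -/
instance : Nonempty VCG := by
  refine ⟨⟨fun B => (exists_first_opt B).choose, fun B => (exists_first_opt B).choose_spec.1.1,
    fun B => (maxWelfare_univ_iff B _ (exists_first_opt B).choose_spec.1.1).2
      (exists_first_opt B).choose_spec.1.2, fun {N} I => ?_⟩⟩
  have : {B : Fin N → Bid | (exists_first_opt B).choose = I} = {B | Opt B I} ∩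
      ⋂ J, ({B | Opt B J}ᶜ ∪ {_B | Fintype.equivFin _ I ≤ Fintype.equivFin _ J}) := by
    ext B
    have hs := (exists_first_opt B).choose_spec
    simp only [Set.mem_ofPred_eq, Set.mem_inter_iff, Set.mem_iInter, Set.mem_union,
      Set.mem_compl_iff, ← imp_iff_not_or]
    constructor
    · rintro rfl; exact hs
    · rintro ⟨h1, h2⟩
      exact (Fintype.equivFin _).injective (le_antisymm (hs.2 _ h1) (h2 _ hs.1))
  rw [this]
  exact (measurableSet_opt I).inter (MeasurableSet.iInter fun J =>
    (measurableSet_opt J).compl.union (MeasurableSet.const _))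

namespace VCG

variable (M : VCG)

/-- The VCG payment of bid `b`: for a winner, the others' maximal welfare in its absence minus the
others' welfare in its presence; for a loser, zero. -/
noncomputable def payment {N : ℕ} (B : Fin N → Bid) (b : Fin N) : ℝ :=
  if b ∈ M.winners B then
    maxWelfare B (Finset.univ.erase b) - (maxWelfare B Finset.univ - Bid.total (B b))
  else 0

/-- The number of items won by the first `m` bids of the profile `B`. -/
def itemsWon {m l : ℕ} (B : Fin (m + l) → Bid) : ℕ :=
  ∑ i : Fin m, if Fin.castAdd l i ∈ M.winners B then (B (Fin.castAdd l i)).1.size else 0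

/-- The quasi-linear utility of a bidder with true type `t` who submits the bids `own` (under `m`
identities) while the other bidders submit the bids `adv`. -/
noncomputable def utility (t : Bid) {m l : ℕ} (own : Fin m → Bid) (adv : Fin l → Bid) : ℝ :=
  (if t.1.size ≤ M.itemsWon (Fin.append own adv) then Bid.total t else 0)
    - ∑ i : Fin m, M.payment (Fin.append own adv) (Fin.castAdd l i)

end VCG

/-- The truthful bid of a bidder of type `t`. -/
def truth (t : Bid) : Fin 1 → Bid := fun _ => t

/-- The false-name attack `(1, x), (1, y)`. -/
def attack (x y : ℝ) : Fin 2 → Bid := ![(Demand.one, x), (Demand.one, y)]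

/-- The bids of `l` truthful adversaries with per-item values `v`, of which the first `k` demand one
item and the others two. -/
def adversaries (k : ℕ) {l : ℕ} (v : Fin l → ℝ) : Fin l → Bid :=
  fun i => (if (i : ℕ) < k then Demand.one else Demand.two, v i)

/-- The uniform distribution on `[0, 1]`. -/
noncomputable def uniform : Measure ℝ := volume.restrict (Set.Icc 0 1)

namespace VCG

variable (M : VCG)

/-- The expected utility among `n` bidders of a bidder of type `t` who submits `own`, when exactly
`k` of the `n - 1` adversaries demand one item, the per-item values of the adversaries being
independent with law `F`. -/
noncomputable def expectedUtilityGiven (F : Measure ℝ) (n k : ℕ) (t : Bid) {m : ℕ}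
    (own : Fin m → Bid) : ℝ :=
  ∫ v : Fin (n - 1) → ℝ, M.utility t own (adversaries k v) ∂(Measure.pi fun _ => F)

/-- The expected utility when each adversary independently demands one item with probability `q`,
so that the number of adversaries demanding one item is binomial with parameters `n - 1`, `q`. -/
noncomputable def expectedUtility (F : Measure ℝ) (n : ℕ) (q : ℝ) (t : Bid) {m : ℕ}
    (own : Fin m → Bid) : ℝ :=
  ∑ k ∈ Finset.range n,
    ((n - 1).choose k : ℝ) * q ^ k * (1 - q) ^ (n - 1 - k) * M.expectedUtilityGiven F n k t own

/-- Truthful bidding is at least as good in expectation as the attack `(1, x), (1, y)` for a bidder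
of type `(g, θ)`. -/
def TruthBeats (F : Measure ℝ) (n : ℕ) (g : Demand) (θ x y q : ℝ) : Prop :=
  M.expectedUtility F n q (g, θ) (attack x y) ≤ M.expectedUtility F n q (g, θ) (truth (g, θ))

end VCG

/-- The least `p ∈ [0, 1]` such that `P q` holds for all `q ∈ (p, 1]`. -/
noncomputable def leastThreshold (P : ℝ → Prop) : ℝ :=
  sInf {p : ℝ | p ∈ Set.Icc (0 : ℝ) 1 ∧ ∀ q ∈ Set.Ioc p 1, P q}

/-- The infimum in `leastThreshold` is always a minimum. -/
theorem isLeast_leastThreshold (P : ℝ → Prop) :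
    IsLeast {p : ℝ | p ∈ Set.Icc (0 : ℝ) 1 ∧ ∀ q ∈ Set.Ioc p 1, P q} (leastThreshold P) := by
  have hbdd : BddBelow {p : ℝ | p ∈ Set.Icc (0 : ℝ) 1 ∧ ∀ q ∈ Set.Ioc p 1, P q} :=
    ⟨0, fun p hp => hp.1.1⟩
  have hone : (1 : ℝ) ∈ {p : ℝ | p ∈ Set.Icc (0 : ℝ) 1 ∧ ∀ q ∈ Set.Ioc p 1, P q} :=
    ⟨by simp, fun q hq => absurd hq.1 (not_lt.2 hq.2)⟩
  refine ⟨⟨⟨le_csInf ⟨1, hone⟩ fun p hp => hp.1.1, csInf_le hbdd hone⟩, fun q hq => ?_⟩,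
    fun p hp => csInf_le hbdd hp⟩
  obtain ⟨p, hp, hpq⟩ := exists_lt_of_csInf_lt ⟨1, hone⟩ hq.1
  exact hp.2 q ⟨hpq, hq.2⟩

/-- The granularity threshold `q*` for `n` bidders, a bidder of type `(g, θ)`, the attack
`(1, x), (1, y)` and the per-item value distribution `F`. -/
noncomputable def granularityThreshold (M : VCG) (F : Measure ℝ) (n : ℕ) (g : Demand)
    (θ x y : ℝ) : ℝ :=
  leastThreshold fun q => M.TruthBeats F n g θ x y q

/-- The granularity threshold `q*` for `n` bidders, a bidder of demand `g` and the per-item value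
distribution `F`, with the value and the attack universally quantified. -/
noncomputable def granularityThresholdOfDemand (M : VCG) (F : Measure ℝ) (n : ℕ)
    (g : Demand) : ℝ :=
  leastThreshold fun q => ∀ θ ∈ Set.Icc (0 : ℝ) 1, ∀ x ∈ Set.Icc (0 : ℝ) 1,
    ∀ y ∈ Set.Icc (0 : ℝ) 1, M.TruthBeats F n g θ x y q

end VCGAuction

namespace VCGAuction

/-! Write l = n - 1, a = `topSingle`, b = `topDouble` and S = `advWelfare` for the adversaries. With
only two items these three numbers determine everything: truth earns max(0, θ + a - S) for demand
one and max(0, 2θ - S) for demand two, and `attack_cases` lists the outcomes of the attack for every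
way of breaking ties. Always 2b ≤ S ≤ max(2a, 2b).

Demand one, y ≤ x (`AttackOutcome.le_one`). If a, b < y, both bids win and each costs at least a, so
the advantage over truth is at most S - 3a. If a < y < b, winning both items against a large double
bid may gain, by at most `gainAbove`. If y < a, the second bid can only raise the price of the
first; this is `lossAbove`. In expectation each effect is controlled for q ≥ 1/2. On {a, b ≤ y} the
expectations of S and a are computed exactly: each is y^(l+1) times a function of l and q, so an
inequality between two coefficients remains (`advWelfare_coeff_le_three_mul_topSingle_coeff`). Above
y, the gain with k single adversaries is charged to the loss with k + 1 of them
(`integral_gainAbove_le`), and the ratio of consecutive binomial weights makes the loss dominate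
(`mixture_gainAbove_le`).

Demand two, split attack. The advantage is at most S - 2 max(a, 2b - θ) on {a, b ≤ θ} and at most
zero elsewhere, almost surely. Its exact expectation `splitGain` has the factor 1 - 2q, which gives
the bound 1/2. For θ = 1 almost every profile lies below θ and the bound is an equality, so the
attack wins for 0 < q < 1/2.

Expectations are found by a layer cake formula: for fixed k the distribution functions are sums of
terms s^k t^(l-k), and averaging over the binomial k turns each into (qs + (1-q)t)^l
(`sum_countWeight_mul`), a power that is integrated by hand. -/

/-! ### Maximal welfare with two items -/

theorem Demand.size_one : Demand.one.size = 1 := rfl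

theorem Demand.one_le_size (d : Demand) : 1 ≤ d.size := by cases d <;> simp [Demand.size]

theorem Demand.eq_one_of_size_le {d : Demand} (h : d.size ≤ 1) : d = Demand.one := by
  cases d
  · rfl
  · simp [Demand.size] at h

theorem Bid.total_one (v : ℝ) : Bid.total (Demand.one, v) = v := by
  simp [Bid.total, Demand.size]

theorem Bid.total_two (v : ℝ) : Bid.total (Demand.two, v) = 2 * v := by
  simp [Bid.total, Demand.size]

theorem Feasible.cases {N : ℕ} {B : Fin N → Bid} {I : Finset (Fin N)} (h : Feasible B I) :
    I = ∅ ∨ (∃ i, I = {i}) ∨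
      ∃ i j, i ≠ j ∧ I = {i, j} ∧ (B i).1 = Demand.one ∧ (B j).1 = Demand.one := by
  have hcard : I.card ≤ 2 := by
    rw [Finset.card_eq_sum_ones]
    exact (Finset.sum_le_sum fun i _ => (B i).1.one_le_size).trans h
  rcases Nat.lt_or_ge I.card 2 with h2 | h2
  · rcases Nat.lt_or_ge I.card 1 with h1 | h1
    · left; exact Finset.card_eq_zero.1 (by omega)
    · right; left; exact Finset.card_eq_one.1 (by omega)
  · right; right
    obtain ⟨i, j, hij, rfl⟩ := Finset.card_eq_two.1 (le_antisymm hcard h2)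
    refine ⟨i, j, hij, rfl, ?_⟩
    unfold Feasible at h
    rw [Finset.sum_pair hij] at h
    have h1 := (B i).1.one_le_size
    have h2 := (B j).1.one_le_size
    exact ⟨Demand.eq_one_of_size_le (by omega), Demand.eq_one_of_size_le (by omega)⟩

/-- Two items leave room only for no bid, one bid, or two unit-demand bids. Describing the maximum
by its upper bounds lets later identities between maxima be checked bound by bound. -/
theorem maxWelfare_le_iff {N : ℕ} (B : Fin N → Bid) (A : Finset (Fin N)) (c : ℝ) :
    maxWelfare B A ≤ c ↔ 0 ≤ c ∧ (∀ i ∈ A, Bid.total (B i) ≤ c) ∧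
      ∀ i ∈ A, ∀ j ∈ A, i ≠ j → (B i).1 = Demand.one → (B j).1 = Demand.one →
        (B i).2 + (B j).2 ≤ c := by
  constructor
  · intro h
    replace h := (Finset.sup'_le_iff _ _).1 h
    refine ⟨?_, fun i hi => ?_, fun i hi j hj hij h1 h2 => ?_⟩
    · simpa [welfare] using h ∅ (by simp [Feasible])
    · have := h {i} (by
        simp only [Finset.mem_filter, Finset.mem_powerset, Finset.singleton_subset_iff]
        refine ⟨hi, ?_⟩
        simp only [Feasible, Finset.sum_singleton]
        cases (B i).1 <;> simp [Demand.size])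
      simpa [welfare] using this
    · have := h {i, j} (by
        simp only [Finset.mem_filter, Finset.mem_powerset]
        refine ⟨by simp [Finset.insert_subset_iff, hi, hj], ?_⟩
        simp only [Feasible, Finset.sum_pair hij, h1, h2, Demand.size]; omega)
      simpa [welfare, Finset.sum_pair hij, Bid.total, h1, h2, Demand.size] using this
  · rintro ⟨h0, h1, h2⟩
    refine Finset.sup'_le _ _ fun I hI => ?_
    simp only [Finset.mem_filter, Finset.mem_powerset] at hI
    rcases hI.2.cases with rfl | ⟨i, rfl⟩ | ⟨i, j, hij, rfl, hi, hj⟩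
    · simpa [welfare] using h0
    · simpa [welfare] using h1 i (hI.1 (by simp))
    · simpa [welfare, Finset.sum_pair hij, Bid.total, hi, hj, Demand.size] using
        h2 i (hI.1 (by simp)) j (hI.1 (by simp)) hij hi hj

theorem welfare_le_maxWelfare {N : ℕ} {B : Fin N → Bid} {A I : Finset (Fin N)} (hI : I ⊆ A)
    (h : Feasible B I) : welfare B I ≤ maxWelfare B A :=
  Finset.le_sup' (welfare B) (by simpa using ⟨hI, h⟩)

theorem maxWelfare_mono {N : ℕ} (B : Fin N → Bid) {A A' : Finset (Fin N)} (h : A ⊆ A') :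
    maxWelfare B A ≤ maxWelfare B A' :=
  Finset.sup'_le _ _ fun I hI => by
    simp only [Finset.mem_filter, Finset.mem_powerset] at hI
    exact welfare_le_maxWelfare (hI.1.trans h) hI.2

/-- Bids outside the winning set do not matter for the maximal welfare. -/
theorem maxWelfare_eq_of_winners_subset (M : VCG) {N : ℕ} (B : Fin N → Bid) {A : Finset (Fin N)}
    (h : M.winners B ⊆ A) : maxWelfare B A = maxWelfare B Finset.univ :=
  le_antisymm (maxWelfare_mono B (Finset.subset_univ _))
    (M.optimal B ▸ welfare_le_maxWelfare h (M.feasible B))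

/-! ### The three statistics a, b, S of the adversaries -/

/-- The largest value among the adversaries demanding one item, `0` if there are none. -/
noncomputable def topSingle {l : ℕ} (k : ℕ) (v : Fin l → ℝ) : ℝ :=
  (Finset.univ.filter fun i : Fin l => (i : ℕ) < k).fold max 0 v

/-- The largest per-item value among the adversaries demanding two items, `0` if there are none. -/
noncomputable def topDouble {l : ℕ} (k : ℕ) (v : Fin l → ℝ) : ℝ :=
  (Finset.univ.filter fun i : Fin l => k ≤ (i : ℕ)).fold max 0 v

/-- The maximal welfare of the adversaries alone. -/
noncomputable def advWelfare {l : ℕ} (k : ℕ) (v : Fin l → ℝ) : ℝ :=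
  maxWelfare (adversaries k v) Finset.univ

section Adversaries

variable {l : ℕ} (k : ℕ) (v : Fin l → ℝ)

theorem topSingle_le_iff (c : ℝ) :
    topSingle k v ≤ c ↔ 0 ≤ c ∧ ∀ i : Fin l, (i : ℕ) < k → v i ≤ c := by
  simp [topSingle, Finset.fold_max_le]

theorem topDouble_le_iff (c : ℝ) :
    topDouble k v ≤ c ↔ 0 ≤ c ∧ ∀ i : Fin l, k ≤ (i : ℕ) → v i ≤ c := by
  simp [topDouble, Finset.fold_max_le]

theorem adversaries_of_lt {i : Fin l} (h : (i : ℕ) < k) :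
    adversaries k v i = (Demand.one, v i) := by simp [adversaries, h]

theorem adversaries_of_le {i : Fin l} (h : k ≤ (i : ℕ)) :
    adversaries k v i = (Demand.two, v i) := by simp [adversaries, h.not_gt]

theorem adversaries_eq_one_iff {i : Fin l} :
    (adversaries k v i).1 = Demand.one ↔ (i : ℕ) < k := by
  simp [adversaries]

theorem advWelfare_le_iff (c : ℝ) :
    advWelfare k v ≤ c ↔ 0 ≤ c ∧ (∀ i : Fin l, (i : ℕ) < k → v i ≤ c) ∧
      (∀ i : Fin l, k ≤ (i : ℕ) → 2 * v i ≤ c) ∧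
      ∀ i j : Fin l, i ≠ j → (i : ℕ) < k → (j : ℕ) < k → v i + v j ≤ c := by
  rw [advWelfare, maxWelfare_le_iff]
  refine and_congr_right fun _ => ?_
  constructor
  · rintro ⟨h1, h2⟩
    refine ⟨fun i hi => ?_, fun i hi => ?_, fun i j hij hi hj => ?_⟩
    · simpa [adversaries_of_lt k v hi, Bid.total_one] using h1 i (Finset.mem_univ _)
    · simpa [adversaries_of_le k v hi, Bid.total_two] using h1 i (Finset.mem_univ _)
    · exact h2 i (Finset.mem_univ _) j (Finset.mem_univ _) hij
        ((adversaries_eq_one_iff k v).2 hi) ((adversaries_eq_one_iff k v).2 hj)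
  · rintro ⟨h1, h2, h3⟩
    refine ⟨fun i _ => ?_, fun i _ j _ hij hi hj => ?_⟩
    · rcases Nat.lt_or_ge i k with hi | hi
      · simpa [adversaries_of_lt k v hi, Bid.total_one] using h1 i hi
      · simpa [adversaries_of_le k v hi, Bid.total_two] using h2 i hi
    · exact h3 i j hij ((adversaries_eq_one_iff k v).1 hi) ((adversaries_eq_one_iff k v).1 hj)

theorem topSingle_nonneg : 0 ≤ topSingle k v := ((topSingle_le_iff k v _).1 le_rfl).1

theorem topDouble_nonneg : 0 ≤ topDouble k v := ((topDouble_le_iff k v _).1 le_rfl).1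

theorem advWelfare_nonneg : 0 ≤ advWelfare k v := ((advWelfare_le_iff k v _).1 le_rfl).1

theorem topSingle_le_advWelfare : topSingle k v ≤ advWelfare k v :=
  (topSingle_le_iff k v _).2 ⟨advWelfare_nonneg k v, ((advWelfare_le_iff k v _).1 le_rfl).2.1⟩

theorem two_mul_topDouble_le_advWelfare : 2 * topDouble k v ≤ advWelfare k v := by
  have h := (advWelfare_le_iff k v _).1 le_rfl
  have : topDouble k v ≤ advWelfare k v / 2 :=
    (topDouble_le_iff k v _).2 ⟨by linarith [h.1], fun i hi => by linarith [h.2.2.1 i hi]⟩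
  linarith

/-- Crude, but enough: with `two_mul_topDouble_le_advWelfare` it gives S = 2b whenever a ≤ b, and it
gives S < 2y whenever a and b are below y. -/
theorem advWelfare_le_max :
    advWelfare k v ≤ max (2 * topDouble k v) (2 * topSingle k v) := by
  have h1 := (topSingle_le_iff k v _).1 le_rfl
  have h2 := (topDouble_le_iff k v _).1 le_rfl
  refine (advWelfare_le_iff k v _).2 ⟨le_max_of_le_right (by linarith [h1.1]), fun i hi => ?_,
    fun i hi => ?_, fun i j _ hi hj => ?_⟩
  · exact le_max_of_le_right (by linarith [h1.1, h1.2 i hi])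
  · exact le_max_of_le_left (by linarith [h2.2 i hi])
  · exact le_max_of_le_right (by linarith [h1.2 i hi, h1.2 j hj])

theorem lt_topSingle_iff {c : ℝ} (hc : 0 ≤ c) :
    c < topSingle k v ↔ ∃ i : Fin l, (i : ℕ) < k ∧ c < v i := by
  rw [← not_le, topSingle_le_iff]
  push Not
  exact ⟨fun h => h hc, fun h _ => h⟩

variable {k v}

theorem le_topSingle {i : Fin l} (h : (i : ℕ) < k) : v i ≤ topSingle k v :=
  ((topSingle_le_iff k v _).1 le_rfl).2 i h

theorem le_topDouble {i : Fin l} (h : k ≤ (i : ℕ)) : v i ≤ topDouble k v :=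
  ((topDouble_le_iff k v _).1 le_rfl).2 i h

end Adversaries

/-! ### Adding own bids to a profile -/

/-- The largest value among the bids in `A` demanding one item, `0` if there are none. -/
noncomputable def maxSingle {N : ℕ} (B : Fin N → Bid) (A : Finset (Fin N)) : ℝ :=
  (A.filter fun i => (B i).1 = Demand.one).fold max 0 fun i => (B i).2

theorem maxSingle_le_iff {N : ℕ} (B : Fin N → Bid) (A : Finset (Fin N)) (c : ℝ) :
    maxSingle B A ≤ c ↔ 0 ≤ c ∧ ∀ i ∈ A, (B i).1 = Demand.one → (B i).2 ≤ c := by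
  simp [maxSingle, Finset.fold_max_le]

section Insert

variable {N : ℕ} {B : Fin N → Bid} {A : Finset (Fin N)} {b : Fin N}

theorem maxSingle_insert (h1 : (B b).1 = Demand.one) :
    maxSingle B (insert b A) = max (maxSingle B A) (B b).2 := by
  refine eq_of_forall_ge_iff fun c => ?_
  rw [max_le_iff, maxSingle_le_iff, maxSingle_le_iff, Finset.forall_mem_insert]
  tauto

theorem maxWelfare_insert_two (h1 : (B b).1 = Demand.two) :
    maxWelfare B (insert b A) = max (maxWelfare B A) (2 * (B b).2) := by
  refine eq_of_forall_ge_iff fun c => ?_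
  have ht : Bid.total (B b) = 2 * (B b).2 := by simp [Bid.total, h1, Demand.size]
  simp only [max_le_iff, maxWelfare_le_iff, Finset.forall_mem_insert, h1, ht, reduceCtorEq,
    false_implies, implies_true, true_and]
  tauto

theorem maxWelfare_insert_one (hb : b ∉ A) (h1 : (B b).1 = Demand.one) :
    maxWelfare B (insert b A) = max (maxWelfare B A) ((B b).2 + maxSingle B A) := by
  refine eq_of_forall_ge_iff fun c => ?_
  have ht : Bid.total (B b) = (B b).2 := by simp [Bid.total, h1, Demand.size]
  have hne : ∀ i ∈ A, i ≠ b := fun i hi h => hb (h ▸ hi)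
  have hs : (B b).2 + maxSingle B A ≤ c ↔
      (B b).2 ≤ c ∧ ∀ i ∈ A, (B i).1 = Demand.one → (B b).2 + (B i).2 ≤ c := by
    rw [← le_sub_iff_add_le', maxSingle_le_iff]
    simp only [le_sub_iff_add_le', add_zero]
  simp only [max_le_iff, maxWelfare_le_iff, Finset.forall_mem_insert, h1, ht, hs]
  constructor
  · rintro ⟨h0, ⟨hx, h2⟩, ⟨-, h3⟩, h4⟩
    exact ⟨⟨h0, h2, fun i hi => (h4 i hi).2⟩, hx, fun i hi h => h3 i hi (hne i hi).symm trivial h⟩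
  · rintro ⟨⟨h0, h2, h4⟩, hx, h3⟩
    refine ⟨h0, ⟨hx, h2⟩, ⟨fun h => absurd rfl h, fun i hi _ _ h => h3 i hi h⟩,
      fun i hi => ⟨fun _ h _ => ?_, h4 i hi⟩⟩
    rw [add_comm]; exact h3 i hi h

theorem maxSingle_nonneg : 0 ≤ maxSingle B A := ((maxSingle_le_iff B A _).1 le_rfl).1

/-- A winning unit-demand bid leaves one item, which can only go to another unit-demand bid. This
identifies the welfare when exactly one of the two attack bids wins. -/
theorem welfare_le_add_maxSingle {I : Finset (Fin N)} (hI : Feasible B I)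
    (hIA : I ⊆ insert b A) (hb : b ∈ I) (h1 : (B b).1 = Demand.one) :
    welfare B I ≤ (B b).2 + maxSingle B A := by
  have ht : Bid.total (B b) = (B b).2 := by simp [Bid.total, h1, Demand.size]
  have h0 := maxSingle_nonneg (B := B) (A := A)
  have hle := ((maxSingle_le_iff B A _).1 le_rfl).2
  have hpair : ∀ j, b ≠ j → (B j).1 = Demand.one → ({b, j} : Finset (Fin N)) ⊆ insert b A →
      welfare B {b, j} ≤ (B b).2 + maxSingle B A := by
    intro j hj hj1 hsub
    have htj : Bid.total (B j) = (B j).2 := by simp [Bid.total, hj1, Demand.size]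
    have hjA : j ∈ A := by
      rcases Finset.mem_insert.1 (hsub (by simp : j ∈ ({b, j} : Finset (Fin N)))) with h | h
      · exact absurd h.symm hj
      · exact h
    rw [welfare, Finset.sum_pair hj, ht, htj]
    linarith [hle j hjA hj1]
  rcases hI.cases with rfl | ⟨i, rfl⟩ | ⟨i, j, hij, rfl, hi, hj⟩
  · simp at hb
  · obtain rfl := Finset.mem_singleton.1 hb
    simp [welfare, ht, h0]
  · rcases Finset.mem_insert.1 hb with rfl | h
    · exact hpair j hij hj hIA
    · obtain rfl := Finset.mem_singleton.1 h
      rw [Finset.pair_comm] at hIA ⊢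
      exact hpair i hij.symm hi hIA

theorem welfare_eq_add {I : Finset (Fin N)} {a : Fin N} (hI : Feasible B I) (hab : a ≠ b)
    (ha : a ∈ I) (hb : b ∈ I) : welfare B I = (B a).2 + (B b).2 := by
  rcases hI.cases with rfl | ⟨i, rfl⟩ | ⟨i, j, hij, rfl, hi, hj⟩
  · simp at ha
  · simp only [Finset.mem_singleton] at ha hb
    exact absurd (ha.trans hb.symm) hab
  · have : welfare B {i, j} = (B i).2 + (B j).2 := by
      simp [welfare, Finset.sum_pair hij, Bid.total, hi, hj, Demand.size]
    rw [this]
    simp only [Finset.mem_insert, Finset.mem_singleton] at ha hb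
    rcases ha with rfl | rfl <;> rcases hb with rfl | rfl
    · exact absurd rfl hab
    · rfl
    · exact add_comm _ _
    · exact absurd rfl hab

end Insert

/-- The bids of the others in a profile whose first `m` bids are one's own. -/
def others (m l : ℕ) : Finset (Fin (m + l)) := Finset.univ.map (Fin.natAddEmb m)

theorem castAdd_notMem_others {m l : ℕ} (i : Fin m) : Fin.castAdd l i ∉ others m l := by
  simp only [others, Finset.mem_map, Finset.mem_univ, true_and, not_exists]
  intro j h
  have := congrArg Fin.val h
  simp at this
  omega

theorem natAdd_mem_others {m l : ℕ} (i : Fin l) : Fin.natAdd m i ∈ others m l := by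
  simp only [others, Finset.mem_map, Finset.mem_univ, true_and]
  exact ⟨i, rfl⟩

theorem univ_eq_truth (l : ℕ) :
    (Finset.univ : Finset (Fin (1 + l))) = insert (Fin.castAdd l 0) (others 1 l) := by
  symm
  rw [Finset.eq_univ_iff_forall, Fin.forall_fin_add]
  exact ⟨fun i => by simp [Subsingleton.elim i 0],
    fun i => Finset.mem_insert_of_mem (natAdd_mem_others i)⟩

theorem univ_eq_attack (l : ℕ) : (Finset.univ : Finset (Fin (2 + l))) =
    insert (Fin.castAdd l 0) (insert (Fin.castAdd l 1) (others 2 l)) := by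
  symm
  rw [Finset.eq_univ_iff_forall, Fin.forall_fin_add]
  exact ⟨fun i => by fin_cases i <;> simp,
    fun i => Finset.mem_insert_of_mem (Finset.mem_insert_of_mem (natAdd_mem_others i))⟩

section Append

variable {m l : ℕ} (own : Fin m → Bid) (k : ℕ) (v : Fin l → ℝ)

theorem maxWelfare_others :
    maxWelfare (Fin.append own (adversaries k v)) (others m l) = advWelfare k v := by
  refine eq_of_forall_ge_iff fun c => ?_
  rw [advWelfare, maxWelfare_le_iff, maxWelfare_le_iff]
  simp [others]

theorem maxSingle_others :
    maxSingle (Fin.append own (adversaries k v)) (others m l) = topSingle k v := by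
  refine eq_of_forall_ge_iff fun c => ?_
  rw [maxSingle_le_iff, topSingle_le_iff]
  simp only [others, Finset.mem_map, Finset.mem_univ, true_and, Fin.natAddEmb_apply,
    forall_exists_index, forall_apply_eq_imp_iff, Fin.append_right, adversaries_eq_one_iff]
  simp [adversaries]

end Append

/-! ### Utilities of truth and of the attack, profile by profile -/

section Truth

variable (M : VCG) {l : ℕ} (k : ℕ) (v : Fin l → ℝ)

/-- A truthful bidder obtains her marginal contribution to the social welfare. -/
theorem utility_truth (t : Bid) :
    M.utility t (truth t) (adversaries k v) =
      maxWelfare (Fin.append (truth t) (adversaries k v)) Finset.univ - advWelfare k v := by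
  set B := Fin.append (truth t) (adversaries k v) with hB
  have he : Finset.univ.erase (Fin.castAdd l (0 : Fin 1)) = others 1 l := by
    rw [univ_eq_truth, Finset.erase_insert (castAdd_notMem_others 0)]
  rw [← maxWelfare_others (truth t) k v, ← hB]
  have ht : truth t 0 = t := rfl
  by_cases h : Fin.castAdd l (0 : Fin 1) ∈ M.winners B
  · simp [VCG.utility, VCG.itemsWon, VCG.payment, ← hB, h, he, ht]
    ring
  · have hsub : M.winners B ⊆ others 1 l := by
      rw [← he]
      exact fun i hi => Finset.mem_erase.2 ⟨fun hi' => h (hi' ▸ hi), Finset.mem_univ _⟩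
    have h1 : ¬ t.1.size ≤ 0 := by have := t.1.one_le_size; omega
    simp [VCG.utility, VCG.itemsWon, VCG.payment, ← hB, h, h1,
      maxWelfare_eq_of_winners_subset M B hsub]

theorem utility_truth_one (θ : ℝ) :
    M.utility (Demand.one, θ) (truth (Demand.one, θ)) (adversaries k v) =
      max 0 (θ + topSingle k v - advWelfare k v) := by
  rw [utility_truth, univ_eq_truth,
    maxWelfare_insert_one (castAdd_notMem_others 0) (by simp [truth]),
    maxWelfare_others, maxSingle_others, Fin.append_left, ← max_sub_sub_right]
  simp [truth]

theorem utility_truth_two (θ : ℝ) :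
    M.utility (Demand.two, θ) (truth (Demand.two, θ)) (adversaries k v) =
      max 0 (2 * θ - advWelfare k v) := by
  rw [utility_truth, univ_eq_truth, maxWelfare_insert_two (by simp [truth]),
    maxWelfare_others, Fin.append_left, ← max_sub_sub_right]
  simp [truth]

end Truth

section Attack

variable (M : VCG) {l : ℕ} (x y : ℝ) (k : ℕ) (v : Fin l → ℝ)

theorem maxWelfare_attack_univ :
    maxWelfare (Fin.append (attack x y) (adversaries k v)) Finset.univ =
      max (max (advWelfare k v) (y + topSingle k v)) (x + max (topSingle k v) y) := by
  have h0 : Fin.castAdd l (0 : Fin 2) ∉ insert (Fin.castAdd l (1 : Fin 2)) (others 2 l) := by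
    simp [castAdd_notMem_others]
  rw [univ_eq_attack, maxWelfare_insert_one h0 (by simp [attack]),
    maxWelfare_insert_one (castAdd_notMem_others 1) (by simp [attack]),
    maxSingle_insert (by simp [attack]), maxWelfare_others, maxSingle_others]
  simp [attack]

theorem maxWelfare_attack_erase_zero :
    maxWelfare (Fin.append (attack x y) (adversaries k v))
      (Finset.univ.erase (Fin.castAdd l 0)) = max (advWelfare k v) (y + topSingle k v) := by
  have h0 : Fin.castAdd l (0 : Fin 2) ∉ insert (Fin.castAdd l (1 : Fin 2)) (others 2 l) := by
    simp [castAdd_notMem_others]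
  rw [univ_eq_attack, Finset.erase_insert h0,
    maxWelfare_insert_one (castAdd_notMem_others 1) (by simp [attack]),
    maxWelfare_others, maxSingle_others]
  simp [attack]

theorem maxWelfare_attack_erase_one :
    maxWelfare (Fin.append (attack x y) (adversaries k v))
      (Finset.univ.erase (Fin.castAdd l 1)) = max (advWelfare k v) (x + topSingle k v) := by
  have h0 : Fin.castAdd l (1 : Fin 2) ∉ insert (Fin.castAdd l (0 : Fin 2)) (others 2 l) := by
    simp [castAdd_notMem_others]
  rw [univ_eq_attack, Finset.insert_comm, Finset.erase_insert h0,
    maxWelfare_insert_one (castAdd_notMem_others 0) (by simp [attack]),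
    maxWelfare_others, maxSingle_others]
  simp [attack]

/-- The possible results of the attack `(1, x), (1, y)`: both bids win, exactly one of them wins,
or none does. -/
theorem attack_cases (t : Bid) :
    (advWelfare k v ≤ x + y ∧ topSingle k v ≤ x ∧ topSingle k v ≤ y ∧
      M.utility t (attack x y) (adversaries k v) = Bid.total t
        - max (advWelfare k v - y) (topSingle k v) - max (advWelfare k v - x) (topSingle k v)) ∨
    (y ≤ topSingle k v ∧ advWelfare k v ≤ x + topSingle k v ∧
      M.utility t (attack x y) (adversaries k v) = (if t.1 = Demand.one then Bid.total t else 0)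
        - max (advWelfare k v - topSingle k v) y) ∨
    (x ≤ topSingle k v ∧ advWelfare k v ≤ y + topSingle k v ∧
      M.utility t (attack x y) (adversaries k v) = (if t.1 = Demand.one then Bid.total t else 0)
        - max (advWelfare k v - topSingle k v) x) ∨
    (x + topSingle k v ≤ advWelfare k v ∧ y + topSingle k v ≤ advWelfare k v ∧
      x + y ≤ advWelfare k v ∧ M.utility t (attack x y) (adversaries k v) = 0) := by
  set B := Fin.append (attack x y) (adversaries k v) with hB
  have hu := maxWelfare_attack_univ x y k v
  have he0 := maxWelfare_attack_erase_zero x y k v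
  have he1 := maxWelfare_attack_erase_one x y k v
  rw [← hB] at hu he0 he1
  have hB0 : B (Fin.castAdd l 0) = (Demand.one, x) := by simp [hB, attack]
  have hB1 : B (Fin.castAdd l 1) = (Demand.one, y) := by simp [hB, attack]
  have hopt := M.optimal B
  have hne : Fin.castAdd l (0 : Fin 2) ≠ Fin.castAdd l 1 := by simp
  have hsize : t.1.size ≤ 1 ↔ t.1 = Demand.one :=
    ⟨Demand.eq_one_of_size_le, fun h => by simp [h, Demand.size]⟩
  have hsize0 : ¬ t.1.size ≤ 0 := by have := t.1.one_le_size; omega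
  have hsize2 : t.1.size ≤ 2 := by cases t.1 <;> simp [Demand.size]
  have key : M.utility t (attack x y) (adversaries k v) =
      (if t.1.size ≤ (if Fin.castAdd l 0 ∈ M.winners B then 1 else 0) +
        (if Fin.castAdd l 1 ∈ M.winners B then 1 else 0) then Bid.total t else 0)
      - ((if Fin.castAdd l 0 ∈ M.winners B then
          maxWelfare B (Finset.univ.erase (Fin.castAdd l 0)) - (maxWelfare B Finset.univ - x) else 0) +
        (if Fin.castAdd l 1 ∈ M.winners B then
          maxWelfare B (Finset.univ.erase (Fin.castAdd l 1)) - (maxWelfare B Finset.univ - y)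
          else 0)) := by
    simp only [VCG.utility, VCG.itemsWon, VCG.payment, ← hB, Fin.sum_univ_two, hB0, hB1,
      Bid.total_one, Demand.size_one]
  have hsub : ∀ i, i ∉ M.winners B → M.winners B ⊆ Finset.univ.erase i := fun i h j hj =>
    Finset.mem_erase.2 ⟨fun h' => h (h' ▸ hj), Finset.mem_univ _⟩
  have hfeas := M.feasible B
  have hs0 : Finset.univ.erase (Fin.castAdd l (0 : Fin 2)) =
      insert (Fin.castAdd l 1) (others 2 l) := by
    rw [univ_eq_attack, Finset.erase_insert (by simp [castAdd_notMem_others])]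
  have hs1 : Finset.univ.erase (Fin.castAdd l (1 : Fin 2)) =
      insert (Fin.castAdd l 0) (others 2 l) := by
    rw [univ_eq_attack, Finset.insert_comm, Finset.erase_insert (by simp [castAdd_notMem_others])]
  have hm := maxSingle_others (attack x y) k v
  rw [← hB] at hm
  have e1 := le_max_left (advWelfare k v) (y + topSingle k v)
  have e2 := le_max_right (advWelfare k v) (y + topSingle k v)
  have e3 := le_max_left (max (advWelfare k v) (y + topSingle k v)) (x + max (topSingle k v) y)
  have e4 := le_max_right (max (advWelfare k v) (y + topSingle k v)) (x + max (topSingle k v) y)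
  have e5 := le_max_left (topSingle k v) y
  have e6 := le_max_right (topSingle k v) y
  rw [hu] at hopt
  by_cases h0 : Fin.castAdd l 0 ∈ M.winners B <;> by_cases h1 : Fin.castAdd l 1 ∈ M.winners B
  · left
    have hw := welfare_eq_add hfeas hne h0 h1
    rw [hB0, hB1] at hw
    refine ⟨by linarith, by linarith, by linarith, ?_⟩
    rw [key, hu, ← hopt, hw, he0, he1]
    simp only [h0, h1, if_true, hsize2, one_add_one_eq_two]
    rw [show max (advWelfare k v - y) (topSingle k v) =
        max (advWelfare k v) (y + topSingle k v) - y by rw [← max_sub_sub_right]; ring_nf,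
      show max (advWelfare k v - x) (topSingle k v) =
        max (advWelfare k v) (x + topSingle k v) - x by rw [← max_sub_sub_right]; ring_nf]
    ring
  · right; left
    -- Only the bid x wins, so the welfare is at most x + a; optimality gives the reverse
    -- inequality, and the order relations of this case follow from the optimum being exactly x + a.
    have hw := welfare_le_add_maxSingle hfeas (hs1 ▸ hsub _ h1) h0 (by rw [hB0])
    rw [hm, hB0] at hw
    simp only at hw
    have hw' : welfare B (M.winners B) = x + topSingle k v := by linarith
    refine ⟨by linarith, by linarith, ?_⟩
    rw [key, hu, ← hopt, hw', he0]
    simp only [h0, h1, if_true, if_false, add_zero, hsize]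
    rw [show max (advWelfare k v - topSingle k v) y =
        max (advWelfare k v) (y + topSingle k v) - topSingle k v by
      rw [← max_sub_sub_right]; ring_nf]
    ring
  · right; right; left
    have hw := welfare_le_add_maxSingle hfeas (hs0 ▸ hsub _ h0) h1 (by rw [hB1])
    rw [hm, hB1] at hw
    simp only at hw
    have hw' : welfare B (M.winners B) = y + topSingle k v := by linarith
    refine ⟨by linarith, by linarith, ?_⟩
    rw [key, hu, ← hopt, hw', he1]
    simp only [h0, h1, if_true, if_false, zero_add, hsize]
    rw [show max (advWelfare k v - topSingle k v) x =
        max (advWelfare k v) (x + topSingle k v) - topSingle k v by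
      rw [← max_sub_sub_right]; ring_nf]
    ring
  · right; right; right
    have hw : welfare B (M.winners B) ≤ advWelfare k v := by
      rw [← maxWelfare_others (attack x y) k v, ← hB]
      refine welfare_le_maxWelfare (fun i hi => ?_) hfeas
      have hi0 := hsub _ h0 hi
      rw [hs0] at hi0
      rcases Finset.mem_insert.1 hi0 with h | h
      · exact absurd (h ▸ hi) h1
      · exact h
    refine ⟨by linarith, by linarith, by linarith, ?_⟩
    rw [key]
    simp [h0, h1, hsize0]

end Attack

/-! ### The law of the adversaries' values -/

instance : IsProbabilityMeasure uniform := ⟨by simp [uniform]⟩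

instance : NullSingletonClass uniform := by unfold uniform; infer_instance

theorem uniform_Iic {c : ℝ} (h1 : c ≤ 1) :
    uniform (Set.Iic c) = ENNReal.ofReal c := by
  rw [uniform, Measure.restrict_apply measurableSet_Iic,
    show Set.Iic c ∩ Set.Icc (0 : ℝ) 1 = Set.Icc 0 c by
      ext z; simp only [Set.mem_inter_iff, Set.mem_Iic, Set.mem_Icc]
      constructor
      · rintro ⟨h, h2, -⟩; exact ⟨h2, h⟩
      · rintro ⟨h, h2⟩; exact ⟨h2, h, h2.trans h1⟩]
  simp

/-- The law of the per-item values of `l` independent adversaries. -/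
noncomputable abbrev valueLaw (l : ℕ) : Measure (Fin l → ℝ) := Measure.pi fun _ => uniform

section Law

variable {l : ℕ}

theorem ae_forall_of_uniform {p : ℝ → Prop} (h : ∀ᵐ s ∂uniform, p s) :
    ∀ᵐ v ∂valueLaw l, ∀ i, p (v i) :=
  ae_all_iff.2 fun i => (measurePreserving_eval (fun _ : Fin l => uniform) i).quasiMeasurePreserving.ae h

theorem ae_values_mem : ∀ᵐ v ∂valueLaw l, ∀ i, v i ∈ Set.Ioc (0 : ℝ) 1 := by
  refine ae_forall_of_uniform ?_
  have h1 : ∀ᵐ s ∂uniform, s ∈ Set.Icc (0 : ℝ) 1 := ae_restrict_mem measurableSet_Icc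
  have h2 : ∀ᵐ s ∂uniform, s ≠ 0 := by simp [ae_iff]
  filter_upwards [h1, h2] with s hs hs0
  exact ⟨lt_of_le_of_ne hs.1 hs0.symm, hs.2⟩

theorem ae_values_ne (c : ℝ) : ∀ᵐ v ∂valueLaw l, ∀ i, v i ≠ c :=
  ae_forall_of_uniform (p := fun s => s ≠ c) (by simp [ae_iff])

theorem valueLaw_box (c : Fin l → ℝ) (h0 : ∀ i, 0 ≤ c i) (h1 : ∀ i, c i ≤ 1) :
    valueLaw l {v | ∀ i, v i ≤ c i} = ENNReal.ofReal (∏ i, c i) := by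
  have : {v : Fin l → ℝ | ∀ i, v i ≤ c i} = Set.univ.pi fun i => Set.Iic (c i) := by
    ext v; simp [Pi.le_def]
  rw [this, Measure.pi_pi, ENNReal.ofReal_prod_of_nonneg fun i _ => h0 i]
  exact Finset.prod_congr rfl fun i _ => uniform_Iic (h1 i)

theorem card_filter_lt {k : ℕ} (hk : k ≤ l) :
    (Finset.univ.filter fun i : Fin l => (i : ℕ) < k).card = k := by
  rw [Fin.card_filter_val_lt]; omega

theorem prod_ite_lt {k : ℕ} (hk : k ≤ l) (s t : ℝ) :
    ∏ i : Fin l, (if (i : ℕ) < k then s else t) = s ^ k * t ^ (l - k) := by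
  rw [Finset.prod_ite, Finset.prod_const, Finset.prod_const, card_filter_lt hk]
  congr 2
  have := Finset.card_filter_add_card_filter_not (s := Finset.univ) fun i : Fin l => (i : ℕ) < k
  rw [card_filter_lt hk, Finset.card_univ, Fintype.card_fin] at this
  omega

theorem real_topSingle_le_topDouble_le {k : ℕ} (hk : k ≤ l) {s t : ℝ} (hs : s ∈ Set.Icc (0 : ℝ) 1)
    (ht : t ∈ Set.Icc (0 : ℝ) 1) :
    (valueLaw l).real {v | topSingle k v ≤ s ∧ topDouble k v ≤ t} = s ^ k * t ^ (l - k) := by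
  have : {v : Fin l → ℝ | topSingle k v ≤ s ∧ topDouble k v ≤ t} =
      {v | ∀ i : Fin l, v i ≤ if (i : ℕ) < k then s else t} := by
    ext v
    simp only [Set.mem_ofPred_eq, topSingle_le_iff, topDouble_le_iff, hs.1, ht.1, true_and]
    constructor
    · rintro ⟨h1, h2⟩ i
      split_ifs with h
      · exact h1 i h
      · exact h2 i (by omega)
    · intro h
      exact ⟨fun i hi => by simpa [hi] using h i, fun i hi => by simpa [hi.not_gt] using h i⟩
  rw [this, measureReal_def, valueLaw_box _ (fun i => by split_ifs <;> simp [hs.1, ht.1])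
    (fun i => by split_ifs <;> simp [hs.2, ht.2]), prod_ite_lt hk, ENNReal.toReal_ofReal]
  exact mul_nonneg (pow_nonneg hs.1 _) (pow_nonneg ht.1 _)

/-- The profiles in which bidder `i` has a value `s` in `(y, c]` and bidder `j` at most `f j s`. -/
def pivotSet {n : ℕ} (f : Fin n → ℝ → ℝ) (y c : ℝ) (i : Fin n) : Set (Fin n → ℝ) :=
  {v | v i ∈ Set.Ioc y c ∧ ∀ j, j ≠ i → v j ≤ f j (v i)}

theorem measurableSet_pivotSet {n : ℕ} {f : Fin n → ℝ → ℝ} (hf : ∀ j, Continuous (f j)) (y c : ℝ)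
    (i : Fin n) : MeasurableSet (pivotSet f y c i) := by
  refine (measurable_pi_apply i measurableSet_Ioc).inter ?_
  change MeasurableSet {v : Fin n → ℝ | ∀ j, j ≠ i → v j ≤ f j (v i)}
  simp only [Set.ofPred_forall]
  refine MeasurableSet.iInter fun j => MeasurableSet.iInter fun _ => ?_
  exact measurableSet_le (measurable_pi_apply j) ((hf j).measurable.comp (measurable_pi_apply i))

/-- Condition on the value s of bidder i (Fubini): the section over s is a box, whose probability is
the product of its side lengths because the values are uniform. -/
theorem real_pivotSet {f : Fin (l + 1) → ℝ → ℝ} (hf : ∀ j, Continuous (f j)) {y c : ℝ}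
    (hy : 0 ≤ y) (hyc : y ≤ c) (hc : c ≤ 1) (hf01 : ∀ j, ∀ s ∈ Set.Ioc y c, f j s ∈ Set.Icc (0 : ℝ) 1)
    (i : Fin (l + 1)) :
    (valueLaw (l + 1)).real (pivotSet f y c i) =
      ∫ s in y..c, ∏ j : Fin l, f (i.succAbove j) s := by
  set T : Set (ℝ × (Fin l → ℝ)) :=
    {p | p.1 ∈ Set.Ioc y c ∧ ∀ j, p.2 j ≤ f (i.succAbove j) p.1} with hT
  have hTm : MeasurableSet T := by
    refine (measurable_fst measurableSet_Ioc).inter ?_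
    change MeasurableSet {p : ℝ × (Fin l → ℝ) | ∀ j, p.2 j ≤ f (i.succAbove j) p.1}
    simp only [Set.ofPred_forall]
    exact MeasurableSet.iInter fun j => measurableSet_le
      ((measurable_pi_apply j).comp measurable_snd) ((hf _).measurable.comp measurable_fst)
  have hpre : pivotSet f y c i = MeasurableEquiv.piFinSuccAbove (fun _ => ℝ) i ⁻¹' T := by
    ext v
    simp only [pivotSet, hT, Set.mem_preimage, Set.mem_ofPred_eq,
      MeasurableEquiv.piFinSuccAbove_apply, Fin.insertNthEquiv_symm_apply]
    refine and_congr_right fun _ => ?_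
    constructor
    · exact fun h j => h _ (Fin.succAbove_ne i j)
    · intro h j hj
      obtain ⟨j, rfl⟩ := Fin.exists_succAbove_eq hj
      exact h j
  have hsec : ∀ s, valueLaw l (Prod.mk s ⁻¹' T) =
      (Set.Ioc y c).indicator (fun s => ENNReal.ofReal (∏ j : Fin l, f (i.succAbove j) s)) s := by
    intro s
    by_cases hs : s ∈ Set.Ioc y c
    · rw [Set.indicator_of_mem hs, ← valueLaw_box _ (fun j => (hf01 _ s hs).1)
        (fun j => (hf01 _ s hs).2)]
      congr 1
      ext w
      simp only [hT, Set.mem_preimage, Set.mem_ofPred_eq, hs, true_and]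
    · rw [Set.indicator_of_notMem hs]
      have : Prod.mk s ⁻¹' T = ∅ := by
        ext w
        simp only [hT, Set.mem_preimage, Set.mem_ofPred_eq, hs, false_and, Set.mem_empty_iff_false]
      rw [this, measure_empty]
  have hsub : Set.Ioc y c ⊆ Set.Icc (0 : ℝ) 1 := fun s hs => ⟨hy.trans hs.1.le, hs.2.trans hc⟩
  rw [measureReal_def, hpre,
    (measurePreserving_piFinSuccAbove (fun _ : Fin (l + 1) => uniform) i).measure_preimage
      hTm.nullMeasurableSet, Measure.prod_apply hTm]
  simp only [hsec]
  rw [lintegral_indicator measurableSet_Ioc, uniform, Measure.restrict_restrict measurableSet_Ioc,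
    Set.inter_eq_left.2 hsub,
    intervalIntegral.integral_of_le hyc, integral_eq_lintegral_of_nonneg_ae]
  · filter_upwards [ae_restrict_mem measurableSet_Ioc] with s hs
    exact Finset.prod_nonneg fun j _ => (hf01 _ s hs).1
  · exact (continuous_finsetProd _ fun j _ => hf _).aestronglyMeasurable

theorem prod_succAbove_ite_lt {k : ℕ} (hk : k ≤ l + 1) {i : Fin (l + 1)} (hi : (i : ℕ) < k) (s t : ℝ) :
    ∏ j : Fin l, (if (i.succAbove j : ℕ) < k then s else t) = s ^ (k - 1) * t ^ (l + 1 - k) := by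
  have h1 : ∑ j : Fin l, (if (i.succAbove j : ℕ) < k then 1 else 0) = k - 1 := by
    have := Fin.sum_univ_succAbove (fun j : Fin (l + 1) => if (j : ℕ) < k then 1 else 0) i
    rw [Finset.sum_boole, card_filter_lt hk, if_pos hi] at this
    simp only [Nat.cast_id] at this
    omega
  have h1 : (Finset.univ.filter fun j : Fin l => (i.succAbove j : ℕ) < k).card = k - 1 := by
    rw [← h1, Finset.sum_boole, Nat.cast_id]
  rw [Finset.prod_ite, Finset.prod_const, Finset.prod_const, h1]
  congr 2
  have := Finset.card_filter_add_card_filter_not (s := Finset.univ)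
    fun j : Fin l => (i.succAbove j : ℕ) < k
  rw [h1, Finset.card_univ, Fintype.card_fin] at this
  omega

/-- The probability that some adversary demanding one item has a value `s` in `(y, c]`, the others
demanding one item at most `φ s`, and those demanding two items at most `ψ s`. -/
theorem real_iUnion_pivotSet {k : ℕ} (hk : k ≤ l + 1) {φ ψ : ℝ → ℝ} (hφ : Continuous φ)
    (hψ : Continuous ψ) {y c : ℝ} (hy : 0 ≤ y) (hyc : y ≤ c) (hc : c ≤ 1)
    (hφ01 : ∀ s ∈ Set.Ioc y c, φ s ∈ Set.Icc (0 : ℝ) 1)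
    (hψ01 : ∀ s ∈ Set.Ioc y c, ψ s ∈ Set.Icc (0 : ℝ) 1) (hlt : ∀ s ∈ Set.Ioc y c, φ s < s) :
    (valueLaw (l + 1)).real (⋃ i ∈ Finset.univ.filter fun i : Fin (l + 1) => (i : ℕ) < k,
      pivotSet (fun j => if (j : ℕ) < k then φ else ψ) y c i) =
      k * ∫ s in y..c, φ s ^ (k - 1) * ψ s ^ (l + 1 - k) := by
  have hcont : ∀ j : Fin (l + 1), Continuous (if (j : ℕ) < k then φ else ψ) := fun j => by
    split_ifs <;> assumption
  rw [measureReal_biUnion_finset]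
  · rw [Finset.sum_congr rfl (g := fun _ => ∫ s in y..c, φ s ^ (k - 1) * ψ s ^ (l + 1 - k)),
      Finset.sum_const, card_filter_lt hk, nsmul_eq_mul]
    intro i hi
    rw [real_pivotSet hcont hy hyc hc]
    · congr 1
      ext s
      rw [← prod_succAbove_ite_lt hk (by simpa using hi)]
      exact Finset.prod_congr rfl fun j _ => by split_ifs <;> rfl
    · intro j s hs
      split_ifs
      exacts [hφ01 s hs, hψ01 s hs]
  -- Disjointness: since φ s < s, the pivot is strictly above every other single adversary, so two
  -- pivots would each exceed the other.
  · intro i hi j hj hij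
    simp only [Finset.coe_filter, Finset.mem_univ, true_and, Set.mem_ofPred_eq] at hi hj
    refine Set.disjoint_left.2 fun v hvi hvj => ?_
    have h1 := hvi.2 j hij.symm
    have h2 := hvj.2 i hij
    simp only [hj, hi, if_true] at h1 h2
    linarith [hlt _ hvi.1, hlt _ hvj.1]
  · exact fun i _ => measurableSet_pivotSet hcont y c i

theorem measurable_topSingle (k : ℕ) : Measurable (topSingle k : (Fin l → ℝ) → ℝ) := by
  refine measurable_of_Iic fun c => ?_
  have : topSingle k ⁻¹' Set.Iic c =
      {v : Fin l → ℝ | 0 ≤ c ∧ ∀ i : Fin l, (i : ℕ) < k → v i ≤ c} := by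
    ext v; simp [topSingle_le_iff]
  rw [this]; measurability

theorem measurable_topDouble (k : ℕ) : Measurable (topDouble k : (Fin l → ℝ) → ℝ) := by
  refine measurable_of_Iic fun c => ?_
  have : topDouble k ⁻¹' Set.Iic c =
      {v : Fin l → ℝ | 0 ≤ c ∧ ∀ i : Fin l, k ≤ (i : ℕ) → v i ≤ c} := by
    ext v; simp [topDouble_le_iff]
  rw [this]; measurability

theorem measurable_advWelfare (k : ℕ) : Measurable (advWelfare k : (Fin l → ℝ) → ℝ) := by
  refine measurable_of_Iic fun c => ?_
  have : advWelfare k ⁻¹' Set.Iic c = {v : Fin l → ℝ |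
      0 ≤ c ∧ (∀ i : Fin l, (i : ℕ) < k → v i ≤ c) ∧ (∀ i : Fin l, k ≤ (i : ℕ) → 2 * v i ≤ c) ∧
      ∀ i j : Fin l, i ≠ j → (i : ℕ) < k → (j : ℕ) < k → v i + v j ≤ c} := by
    ext v; simp [advWelfare_le_iff]
  rw [this]; measurability

end Law

/-! ### Layer cake formulas and elementary integrals -/

section LayerCake

variable {Ω : Type*} [MeasurableSpace Ω] (μ : Measure Ω) [IsFiniteMeasure μ] {S : Set Ω}
  {f : Ω → ℝ} {c : ℝ}

theorem integrable_indicator_of_le (hS : MeasurableSet S) (hf : Measurable f) (hc : 0 ≤ c)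
    (h0 : ∀ x ∈ S, 0 ≤ f x) (h1 : ∀ x ∈ S, f x ≤ c) : Integrable (S.indicator f) μ :=
  Integrable.of_bound (hf.indicator hS).aestronglyMeasurable c
    (Filter.Eventually.of_forall fun x => by
      rw [Real.norm_of_nonneg (Set.indicator_nonneg h0 x)]
      exact Set.indicator_le' h1 (fun _ _ => hc) x)

/-- A layer cake formula for a bounded function on a part of a finite measure space. -/
theorem integral_indicator_eq_integral_le (hS : MeasurableSet S) (hf : Measurable f)
    (hc : 0 ≤ c) (h0 : ∀ x ∈ S, 0 ≤ f x) (h1 : ∀ x ∈ S, f x ≤ c) :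
    ∫ x, S.indicator f x ∂μ = ∫ u in 0..c, μ.real (S ∩ {x | u ≤ f x}) := by
  rw [(integrable_indicator_of_le μ hS hf hc h0 h1).integral_eq_integral_Ioc_meas_le
    (Filter.Eventually.of_forall fun x => Set.indicator_nonneg h0 x)
    (Filter.Eventually.of_forall fun x => Set.indicator_le' h1 (fun _ _ => hc) x),
    intervalIntegral.integral_of_le hc]
  refine setIntegral_congr_fun measurableSet_Ioc fun u hu => ?_
  have hu0 : ¬ u ≤ 0 := not_le.2 hu.1
  have : {a | u ≤ S.indicator f a} = S ∩ {x | u ≤ f x} := by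
    ext x
    by_cases hx : x ∈ S
    · simp [hx]
    · simp [hx, hu0]
  simp only [this]

/-- Level sets of positive measure occur only for a null set of levels u. The strict form suits the
upper bound for the gain, the weak form the lower bound for the loss. -/
theorem integral_indicator_eq_integral_lt (hS : MeasurableSet S) (hf : Measurable f)
    (hc : 0 ≤ c) (h0 : ∀ x ∈ S, 0 ≤ f x) (h1 : ∀ x ∈ S, f x ≤ c) :
    ∫ x, S.indicator f x ∂μ = ∫ u in 0..c, μ.real (S ∩ {x | u < f x}) := by
  rw [integral_indicator_eq_integral_le μ hS hf hc h0 h1]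
  refine intervalIntegral.integral_congr_ae ?_
  have := meas_le_ae_eq_meas_lt (μ.restrict S) volume f
  filter_upwards [this] with u hu _
  rw [Measure.restrict_apply (measurableSet_le measurable_const hf),
    Measure.restrict_apply (measurableSet_lt measurable_const hf)] at hu
  rw [measureReal_def, measureReal_def, Set.inter_comm, hu, Set.inter_comm]

theorem integral_indicator_eq_integral_sub (hS : MeasurableSet S) (hf : Measurable f)
    (hc : 0 ≤ c) (h0 : ∀ x ∈ S, 0 ≤ f x) (h1 : ∀ x ∈ S, f x ≤ c) :
    ∫ x, S.indicator f x ∂μ = ∫ u in 0..c, (μ.real S - μ.real (S ∩ {x | f x ≤ u})) := by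
  rw [integral_indicator_eq_integral_lt μ hS hf hc h0 h1]
  refine intervalIntegral.integral_congr fun u _ => ?_
  have : S ∩ {x | u < f x} = S \ (S ∩ {x | f x ≤ u}) := by
    ext x
    simp only [Set.mem_inter_iff, Set.mem_ofPred_eq, Set.mem_sdiff, not_and, not_le]
    exact ⟨fun h => ⟨h.1, fun _ => h.2⟩, fun h => ⟨h.1, h.2 h.1⟩⟩
  rw [this]
  exact measureReal_sdiff Set.inter_subset_left (hS.inter (hf measurableSet_Iic))

end LayerCake

theorem integral_linear_pow (n : ℕ) {α : ℝ} (hα : α ≠ 0) (β a b : ℝ) :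
    ∫ u in a..b, (α * u + β) ^ n =
      ((α * b + β) ^ (n + 1) - (α * a + β) ^ (n + 1)) / (α * (n + 1)) := by
  have hn : (n : ℝ) + 1 ≠ 0 := by positivity
  rw [intervalIntegral.integral_eq_sub_of_hasDerivAt
    (f := fun u => (α * u + β) ^ (n + 1) / (α * (n + 1)))]
  · ring
  · intro u _
    have h : HasDerivAt (fun u => (α * u + β) ^ (n + 1) / (α * (n + 1))) _ u :=
      ((((hasDerivAt_id' u).const_mul α).add_const β).pow (n + 1)).div_const (α * (n + 1))
    refine h.congr_deriv ?_
    push_cast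
    simp only [mul_one]
    field_simp
  · exact (by fun_prop : Continuous fun u : ℝ => (α * u + β) ^ n).intervalIntegrable _ _

/-- Also correct for k = 0, where the exponent k - 1 truncates but the factor k makes both sides
vanish. -/
theorem mul_integral_sub_pow (k : ℕ) (d a b : ℝ) :
    k * ∫ s in a..b, (d - s) ^ (k - 1) = (d - a) ^ k - (d - b) ^ k := by
  rw [← intervalIntegral.integral_const_mul, intervalIntegral.integral_eq_sub_of_hasDerivAt
    (f := fun s => - (d - s) ^ k)]
  · ring
  · intro u _
    have h : HasDerivAt (fun s => -(d - s) ^ k) _ u := (((hasDerivAt_id' u).const_sub d).pow k).neg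
    exact h.congr_deriv (by ring)
  · exact (by fun_prop : Continuous fun s : ℝ => (k : ℝ) * (d - s) ^ (k - 1)).intervalIntegrable _ _

/-! ### Expectations over the profiles below y -/

/-- The profiles of values at most `y`. -/
def valuesBelow {l : ℕ} (k : ℕ) (y : ℝ) : Set (Fin l → ℝ) :=
  {v | topSingle k v ≤ y ∧ topDouble k v ≤ y}

section Below

variable {l k : ℕ} {y : ℝ}

theorem measurableSet_valuesBelow : MeasurableSet (valuesBelow k y : Set (Fin l → ℝ)) :=
  (measurableSet_le (measurable_topSingle k) measurable_const).inter
    (measurableSet_le (measurable_topDouble k) measurable_const)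

theorem real_valuesBelow (hk : k ≤ l) (hy : y ∈ Set.Icc (0 : ℝ) 1) :
    (valueLaw l).real (valuesBelow k y) = y ^ l := by
  rw [valuesBelow, real_topSingle_le_topDouble_le hk hy hy, ← pow_add]
  congr 1; omega

theorem integral_valuesBelow_topSingle (hk : k ≤ l) (hy : y ∈ Set.Icc (0 : ℝ) 1) :
    ∫ v, (valuesBelow k y).indicator (topSingle k) v ∂valueLaw l =
      ∫ u in 0..y, (y ^ l - u ^ k * y ^ (l - k)) := by
  rw [integral_indicator_eq_integral_sub _ measurableSet_valuesBelow (measurable_topSingle k) hy.1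
    (fun v _ => topSingle_nonneg k v) fun v hv => hv.1]
  refine intervalIntegral.integral_congr fun u hu => ?_
  rw [Set.uIcc_of_le hy.1] at hu
  rw [real_valuesBelow hk hy,
    ← real_topSingle_le_topDouble_le hk ⟨hu.1, hu.2.trans hy.2⟩ hy]
  congr 2
  ext v
  simp only [valuesBelow, Set.mem_inter_iff, Set.mem_ofPred_eq]
  exact ⟨fun h => ⟨h.2, h.1.2⟩, fun h => ⟨⟨h.1.trans hu.2, h.2⟩, h.1⟩⟩

theorem integral_valuesBelow_max (hk : k ≤ l) (hy : y ∈ Set.Icc (0 : ℝ) 1) :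
    ∫ v, (valuesBelow k y).indicator
      (fun v => max (topSingle k v) (2 * topDouble k v - y)) v ∂valueLaw l =
      ∫ u in 0..y, (y ^ l - u ^ k * ((u + y) / 2) ^ (l - k)) := by
  rw [integral_indicator_eq_integral_sub _ measurableSet_valuesBelow
    ((measurable_topSingle k).max (((measurable_topDouble k).const_mul 2).sub_const y)) hy.1
    (fun v _ => le_max_of_le_left (topSingle_nonneg k v))
    fun v hv => max_le hv.1 (by linarith [hv.2])]
  refine intervalIntegral.integral_congr fun u hu => ?_
  rw [Set.uIcc_of_le hy.1] at hu
  rw [real_valuesBelow hk hy, ← real_topSingle_le_topDouble_le hk ⟨hu.1, hu.2.trans hy.2⟩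
    (t := (u + y) / 2) ⟨by linarith [hu.1, hy.1], by linarith [hu.2, hy.2]⟩]
  congr 2
  ext v
  simp only [valuesBelow, Set.mem_inter_iff, Set.mem_ofPred_eq, max_le_iff]
  exact ⟨fun h => ⟨h.2.1, by linarith [h.2.2]⟩,
    fun h => ⟨⟨h.1.trans hu.2, by linarith [h.2, hu.2]⟩, h.1, by linarith [h.2]⟩⟩

/-- Welfare at most 2t forces b ≤ t. Either all values are at most t, with probability t^l, or
exactly one single adversary has a value s > t, and then the other singles are at most 2t - s;
integrating over s in (t, min(y, 2t)] gives the rest. For k = 0 the convention 0^0 = 1 leaves t^l,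
as it should. -/
theorem real_valuesBelow_inter_advWelfare (hl : l ≠ 0) (hk : k ≤ l) (hy : y ≤ 1) {t : ℝ}
    (ht : 0 < t) (hty : t ≤ y) :
    (valueLaw l).real (valuesBelow k y ∩ {v | advWelfare k v ≤ 2 * t}) =
      2 * t ^ l - max 0 (2 * t - y) ^ k * t ^ (l - k) := by
  obtain ⟨l, rfl⟩ := Nat.exists_eq_succ_of_ne_zero hl
  rw [Nat.succ_eq_add_one] at *
  set φ : ℝ → ℝ := fun s => 2 * t - s with hφ
  set ψ : ℝ → ℝ := fun _ => t with hψ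
  have hφc : Continuous φ := by fun_prop
  have hψc : Continuous ψ := by fun_prop
  set U := ⋃ i ∈ Finset.univ.filter fun i : Fin (l + 1) => (i : ℕ) < k,
      pivotSet (fun j => if (j : ℕ) < k then φ else ψ) t (min y (2 * t)) i with hU
  have hUm : MeasurableSet U := Finset.measurableSet_biUnion _ fun i _ =>
    measurableSet_pivotSet (fun j => by split_ifs <;> assumption) _ _ _
  have hpiv := real_iUnion_pivotSet (l := l) hk hφc hψc ht.le (le_min hty (by linarith))
    ((min_le_left _ _).trans hy) (c := min y (2 * t))
    (fun s hs => ⟨by simp only [hφ]; linarith [hs.2.trans (min_le_right _ _)],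
      by simp only [hφ]; linarith [hs.1]⟩) (fun s _ => ⟨ht.le, hty.trans hy⟩)
    (fun s hs => by simp only [hφ]; linarith [hs.1])
  rw [← hU] at hpiv
  have hdisj : Disjoint (valuesBelow k t) U := by
    refine Set.disjoint_left.2 fun v hv hvU => ?_
    simp only [hU, Set.mem_iUnion, Finset.mem_filter, Finset.mem_univ, true_and] at hvU
    obtain ⟨i, hi, hvi⟩ := hvU
    exact absurd hvi.1.1 (not_lt.2 ((le_topSingle hi).trans hv.1))
  have hae : (valuesBelow k y ∩ {v | advWelfare k v ≤ 2 * t} : Set (Fin (l + 1) → ℝ))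
      =ᵐ[valueLaw (l + 1)] (valuesBelow k t ∪ U : Set (Fin (l + 1) → ℝ)) := by
    filter_upwards [ae_values_mem] with v hv
    refine propext ?_
    change (v ∈ valuesBelow k y ∧ advWelfare k v ≤ 2 * t) ↔ (v ∈ valuesBelow k t ∨ v ∈ U)
    simp only [hU, Set.mem_iUnion, Finset.mem_filter, Finset.mem_univ, true_and]
    constructor
    · rintro ⟨h1, h2⟩
      have hb : topDouble k v ≤ t := by linarith [two_mul_topDouble_le_advWelfare k v]
      rcases le_or_gt (topSingle k v) t with ha | ha
      · exact Or.inl ⟨ha, hb⟩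
      · right
        obtain ⟨i, hi, hti⟩ := (lt_topSingle_iff k v ht.le).1 ha
        have h3 := (advWelfare_le_iff k v _).1 h2
        refine ⟨i, hi, ⟨hti, le_min ((le_topSingle hi).trans h1.1) (h3.2.1 i hi)⟩, fun j hj => ?_⟩
        by_cases hjk : (j : ℕ) < k
        · simp only [hjk, if_true]
          simp only [hφ]
          linarith [h3.2.2.2 j i hj hjk hi]
        · simp only [hjk, if_false]
          exact (le_topDouble (not_lt.1 hjk)).trans hb
    · rintro (h | ⟨i, hi, hvi, hvj⟩)
      · refine ⟨⟨h.1.trans hty, h.2.trans hty⟩, (advWelfare_le_max k v).trans ?_⟩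
        exact max_le (by linarith [h.2]) (by linarith [h.1])
      · have hs : ∀ j : Fin (l + 1), j ≠ i → (j : ℕ) < k → v j ≤ 2 * t - v i := fun j hj hjk => by
          simpa [hjk, hφ] using hvj j hj
        have hd : ∀ j : Fin (l + 1), k ≤ (j : ℕ) → v j ≤ t := fun j hjk => by
          have hj : j ≠ i := fun h => by rw [h] at hjk; omega
          simpa [hjk.not_gt, hψ] using hvj j hj
        have hy0 : 0 ≤ y := ht.le.trans hty
        have hi1 := hvi.1
        have hi2 := hvi.2.trans (min_le_left _ _)
        have hi3 := hvi.2.trans (min_le_right _ _)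
        refine ⟨⟨(topSingle_le_iff k v y).2 ⟨hy0, fun j hj => ?_⟩,
          (topDouble_le_iff k v y).2 ⟨hy0, fun j hj => (hd j hj).trans hty⟩⟩,
          (advWelfare_le_iff k v _).2 ⟨by linarith, fun j hj => ?_, fun j hj => by linarith [hd j hj],
            fun j m hjm hj hm => ?_⟩⟩
        · rcases eq_or_ne j i with rfl | h
          · exact hi2
          · linarith [hs j h hj]
        · rcases eq_or_ne j i with rfl | h
          · exact hi3
          · linarith [hs j h hj]
        · rcases eq_or_ne j i with rfl | h
          · linarith [hs m hjm.symm hm]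
          · rcases eq_or_ne m i with rfl | h'
            · linarith [hs j h hj]
            · linarith [hs j h hj, hs m h' hm]
  rw [measureReal_congr hae, measureReal_union hdisj hUm (measure_ne_top _ _)
    (measure_ne_top _ _), hpiv, real_valuesBelow hk ⟨ht.le, hty.trans hy⟩]
  simp only [hφ, hψ]
  rw [intervalIntegral.integral_mul_const, ← mul_assoc,
    mul_integral_sub_pow, show 2 * t - min y (2 * t) = max 0 (2 * t - y) by
      rcases le_total y (2 * t) with h | h
      · rw [min_eq_left h, max_eq_right (by linarith)]
      · rw [min_eq_right h, max_eq_left (by linarith)]; ring]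
  have : t ^ (l + 1) = t ^ k * t ^ (l + 1 - k) := by rw [← pow_add]; congr 1; omega
  rw [this]; ring

theorem integral_valuesBelow_advWelfare (hl : l ≠ 0) (hk : k ≤ l) (hy : y ∈ Set.Icc (0 : ℝ) 1) :
    ∫ v, (valuesBelow k y).indicator (advWelfare k) v ∂valueLaw l =
      ∫ u in 0..2 * y, (y ^ l - (2 * (u / 2) ^ l - max 0 (u - y) ^ k * (u / 2) ^ (l - k))) := by
  have hy2 : 0 ≤ 2 * y := by linarith [hy.1]
  rw [integral_indicator_eq_integral_sub _ measurableSet_valuesBelow (measurable_advWelfare k) hy2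
    (fun v _ => advWelfare_nonneg k v) fun v hv => (advWelfare_le_max k v).trans
      (max_le (by linarith [hv.2]) (by linarith [hv.1])),
    intervalIntegral.integral_of_le hy2, intervalIntegral.integral_of_le hy2]
  refine setIntegral_congr_fun measurableSet_Ioc fun u hu => ?_
  rw [real_valuesBelow hk hy]
  have := real_valuesBelow_inter_advWelfare hl hk hy.2 (t := u / 2) (by linarith [hu.1])
    (by linarith [hu.2])
  rw [mul_div_cancel₀ u two_ne_zero] at this
  rw [this]

end Below

/-! ### Gain against loss when some adversary is above y -/

section GainLoss

variable {l : ℕ} (k : ℕ) (y : ℝ)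

/-- A bound for the gain by the attack `(1, x), (1, y)` when it wins both items against a bid for
two items of per-item value at least `y`. -/
noncomputable def gainAbove : (Fin l → ℝ) → ℝ :=
  {v | y ≤ topDouble k v}.indicator
    fun v => max 0 (y - max (topSingle k v) (2 * topDouble k v - 1))

/-- A bound for the loss by the attack `(1, x), (1, y)` when the bid `y` raises the price of the
first item. -/
noncomputable def lossAbove : (Fin l → ℝ) → ℝ :=
  {v | y < topSingle k v}.indicator fun v => max 0 (y - (advWelfare k v - topSingle k v))

variable {y}

theorem integrable_gainAbove (hy : 0 ≤ y) : Integrable (gainAbove k y) (valueLaw l) := by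
  refine integrable_indicator_of_le _ (measurableSet_le measurable_const (measurable_topDouble k))
    (measurable_const.max (measurable_const.sub ((measurable_topSingle k).max
      (((measurable_topDouble k).const_mul 2).sub_const 1)))) hy
    (fun v _ => le_max_left _ _) fun v _ => max_le hy ?_
  linarith [topSingle_nonneg k v, le_max_left (topSingle k v) (2 * topDouble k v - 1)]

theorem integrable_lossAbove (hy : 0 ≤ y) : Integrable (lossAbove k y) (valueLaw l) := by
  refine integrable_indicator_of_le _ (measurableSet_lt measurable_const (measurable_topSingle k))
    (measurable_const.max (measurable_const.sub ((measurable_advWelfare k).sub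
      (measurable_topSingle k)))) hy
    (fun v _ => le_max_left _ _) fun v _ => max_le hy ?_
  linarith [topSingle_le_advWelfare k v]

theorem lossAbove_nonneg (v : Fin l → ℝ) : 0 ≤ lossAbove k y v :=
  Set.indicator_nonneg (fun _ _ => le_max_left _ _) v

theorem gainAbove_self (v : Fin l → ℝ) : gainAbove l y v = 0 := by
  have hd : topDouble l v = 0 := le_antisymm
    ((topDouble_le_iff l v 0).2 ⟨le_rfl, fun i hi => absurd i.2 hi.not_gt⟩) (topDouble_nonneg l v)
  refine Set.indicator_apply_eq_zero.2 fun h => ?_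
  have h : y ≤ topDouble l v := h
  refine max_eq_left ?_
  linarith [topSingle_nonneg l v, le_max_left (topSingle l v) (2 * topDouble l v - 1)]

variable {k}

/-- A gain above u forces a < y - u and b < (1 + (y - u))/2. The condition b ≥ y is deliberately
weakened to b > (y + (y - u))/2: the difference of powers is then the increment over s from y to 1
of ((s + (y - u))/2)^(l - k), which matches the integral in `real_lossAbove_ge`. -/
theorem real_gainAbove_le (hk : k ≤ l) (hy : y ∈ Set.Icc (0 : ℝ) 1) {u : ℝ}
    (hu : u ∈ Set.Ioo 0 y) :
    (valueLaw l).real ({v | y ≤ topDouble k v} ∩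
      {v | u < max 0 (y - max (topSingle k v) (2 * topDouble k v - 1))}) ≤
    (y - u) ^ k * (((1 + (y - u)) / 2) ^ (l - k) - ((y + (y - u)) / 2) ^ (l - k)) := by
  obtain ⟨hu0, huy⟩ := hu
  obtain ⟨hy0, hy1⟩ := hy
  set R : ℝ → Set (Fin l → ℝ) := fun t => {v | topSingle k v ≤ y - u ∧ topDouble k v ≤ t} with hR
  have hRr : ∀ t ∈ Set.Icc (0 : ℝ) 1, (valueLaw l).real (R t) = (y - u) ^ k * t ^ (l - k) :=
    fun t ht => real_topSingle_le_topDouble_le hk ⟨by linarith, by linarith⟩ ht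
  rw [mul_sub, ← hRr _ ⟨by linarith, by linarith⟩, ← hRr _ ⟨by linarith, by linarith⟩,
    ← measureReal_sdiff]
  · refine measureReal_mono fun v hv => ?_
    obtain ⟨h1, h2⟩ := hv
    have h1 : y ≤ topDouble k v := h1
    have h2 : u < max 0 (y - max (topSingle k v) (2 * topDouble k v - 1)) := h2
    rcases lt_max_iff.1 h2 with h | h
    · linarith
    · have h3 := le_max_left (topSingle k v) (2 * topDouble k v - 1)
      have h4 := le_max_right (topSingle k v) (2 * topDouble k v - 1)
      exact ⟨⟨by linarith, by linarith⟩, fun h5 => by linarith [h5.2]⟩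
  · exact fun v hv => ⟨hv.1, by linarith [hv.2]⟩
  · exact (measurableSet_le (measurable_topSingle k) measurable_const).inter
      (measurableSet_le (measurable_topDouble k) measurable_const)

/-- Let one single adversary have value s > y, the other singles at most y - u, and the doubles at
most (s + (y - u))/2. Then S ≤ s + (y - u) while a ≥ s, so S - a ≤ y - u and the loss is at least u.
-/
theorem real_lossAbove_ge (hl : l ≠ 0) (hk : k ≤ l) (hy : y ∈ Set.Icc (0 : ℝ) 1) {u : ℝ}
    (hu : u ∈ Set.Ioo 0 y) :
    k * ∫ s in y..1, (y - u) ^ (k - 1) * ((s + (y - u)) / 2) ^ (l - k) ≤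
    (valueLaw l).real ({v | y < topSingle k v} ∩
      {v | u ≤ max 0 (y - (advWelfare k v - topSingle k v))}) := by
  obtain ⟨hu0, huy⟩ := hu
  obtain ⟨hy0, hy1⟩ := hy
  obtain ⟨l, rfl⟩ := Nat.exists_eq_succ_of_ne_zero hl
  rw [Nat.succ_eq_add_one] at *
  rw [← real_iUnion_pivotSet hk (φ := fun _ => y - u) (ψ := fun s => (s + (y - u)) / 2)
    (by fun_prop) (by fun_prop) hy0 hy1 le_rfl (fun s _ => ⟨by linarith, by linarith⟩)
    (fun s hs => ⟨by linarith [hs.1], by linarith [hs.2]⟩) (fun s hs => by linarith [hs.1])]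
  refine measureReal_mono fun v hv => ?_
  simp only [Set.mem_iUnion, Finset.mem_filter, Finset.mem_univ, true_and] at hv
  obtain ⟨i, hi, hvi, hvj⟩ := hv
  have hi1 := hvi.1
  have hs : ∀ j : Fin (l + 1), j ≠ i → (j : ℕ) < k → v j ≤ y - u := fun j hj hjk => by
    simpa [hjk] using hvj j hj
  have hd : ∀ j : Fin (l + 1), k ≤ (j : ℕ) → v j ≤ (v i + (y - u)) / 2 := fun j hjk => by
    have hj : j ≠ i := fun h => by rw [h] at hjk; omega
    simpa [hjk.not_gt] using hvj j hj
  have ht := le_topSingle (v := v) hi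
  have hw : advWelfare k v ≤ v i + (y - u) := by
    refine (advWelfare_le_iff k v _).2 ⟨by linarith, fun j hj => ?_, fun j hj => ?_,
      fun j m hjm hj hm => ?_⟩
    · rcases eq_or_ne j i with rfl | h
      · linarith
      · linarith [hs j h hj]
    · linarith [hd j hj]
    · rcases eq_or_ne j i with rfl | h
      · linarith [hs m hjm.symm hm]
      · rcases eq_or_ne m i with rfl | h'
        · linarith [hs j h hj]
        · linarith [hs j h hj, hs m h' hm]
  exact ⟨hi1.trans_le ht, le_max_of_le_right
    (show u ≤ y - (advWelfare k v - topSingle k v) by linarith)⟩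

/-- The gain with `k` adversaries demanding one item against the loss with `k + 1` of them. -/
theorem integral_gainAbove_le (hk : k < l) (hy : y ∈ Set.Icc (0 : ℝ) 1) :
    2 * (k + 1) * ∫ v, gainAbove k y v ∂valueLaw l ≤
      (l - k : ℕ) * ∫ v, lossAbove (k + 1) y v ∂valueLaw l := by
  have hgm : Measurable fun v : Fin l → ℝ =>
      max 0 (y - max (topSingle k v) (2 * topDouble k v - 1)) :=
    measurable_const.max (measurable_const.sub ((measurable_topSingle k).max
      (((measurable_topDouble k).const_mul 2).sub_const 1)))
  have hlm : Measurable fun v : Fin l → ℝ =>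
      max 0 (y - (advWelfare (k + 1) v - topSingle (k + 1) v)) :=
    measurable_const.max (measurable_const.sub ((measurable_advWelfare _).sub
      (measurable_topSingle _)))
  unfold gainAbove lossAbove
  rw [integral_indicator_eq_integral_lt _
      (measurableSet_le measurable_const (measurable_topDouble k)) hgm hy.1
      (fun v _ => le_max_left _ _) (fun v _ => max_le hy.1 (by
        linarith [topSingle_nonneg k v, le_max_left (topSingle k v) (2 * topDouble k v - 1)])),
    integral_indicator_eq_integral_le _
      (measurableSet_lt measurable_const (measurable_topSingle _)) hlm hy.1
      (fun v _ => le_max_left _ _) (fun v _ => max_le hy.1 (by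
        linarith [topSingle_le_advWelfare (k + 1) v])),
    ← intervalIntegral.integral_const_mul, ← intervalIntegral.integral_const_mul]
  refine intervalIntegral.integral_mono_on_of_le_Ioo hy.1 ?_ ?_ fun u hu => ?_
  -- Tail probabilities are antitone in the level, hence integrable.
  · refine (AntitoneOn.intervalIntegrable fun u _ u' _ huu => ?_).const_mul _
    exact measureReal_mono (Set.inter_subset_inter_right _ fun v hv => lt_of_le_of_lt huu hv)
  · refine (AntitoneOn.intervalIntegrable fun u _ u' _ huu => ?_).const_mul _
    exact measureReal_mono (Set.inter_subset_inter_right _ fun v hv => le_trans huu hv)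
  · have h1 := real_gainAbove_le hk.le hy hu
    have h2 := real_lossAbove_ge (l := l) (by omega) (k := k + 1) hk hy hu
    rw [intervalIntegral.integral_const_mul, Nat.add_sub_cancel] at h2
    obtain ⟨m, rfl⟩ : ∃ m, l = k + 1 + m := ⟨l - (k + 1), by omega⟩
    rw [show k + 1 + m - (k + 1) = m by omega] at h2
    rw [show k + 1 + m - k = m + 1 by omega] at h1 ⊢
    -- The bound for the gain with k singles equals, up to the factor 2(k+1)/(l-k), the bound for
    -- the loss with k + 1 singles, at every level u: one double adversary is traded for the pivotal
    -- single one.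
    have h3 : ((m + 1 : ℕ) : ℝ) * ∫ s in y..1, ((s + (y - u)) / 2) ^ m =
        2 * (((1 + (y - u)) / 2) ^ (m + 1) - ((y + (y - u)) / 2) ^ (m + 1)) := by
      have := integral_linear_pow m (α := 1 / 2) (by norm_num) ((y - u) / 2) y 1
      rw [show (fun s : ℝ => ((s + (y - u)) / 2) ^ m) = fun s =>
        (1 / 2 * s + (y - u) / 2) ^ m by ext s; ring_nf, this]
      push_cast
      field_simp
    calc 2 * ((k : ℝ) + 1) * _ ≤ 2 * ((k : ℝ) + 1) * _ :=
          mul_le_mul_of_nonneg_left h1 (by positivity)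
      _ = ((m + 1 : ℕ) : ℝ) * (((k + 1 : ℕ) : ℝ) * ((y - u) ^ k *
            ∫ s in y..1, ((s + (y - u)) / 2) ^ m)) := by
          rw [show ((m + 1 : ℕ) : ℝ) * (((k + 1 : ℕ) : ℝ) * ((y - u) ^ k *
            ∫ s in y..1, ((s + (y - u)) / 2) ^ m)) = ((k + 1 : ℕ) : ℝ) * (y - u) ^ k *
            (((m + 1 : ℕ) : ℝ) * ∫ s in y..1, ((s + (y - u)) / 2) ^ m) by ring, h3]
          push_cast
          ring
      _ ≤ _ := mul_le_mul_of_nonneg_left h2 (by positivity)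

end GainLoss

/-! ### Averaging over the binomial number of single adversaries -/

/-- The probability that exactly `k` of `l` adversaries demand one item. -/
noncomputable def countWeight (l : ℕ) (q : ℝ) (k : ℕ) : ℝ := (l.choose k : ℝ) * q ^ k * (1 - q) ^ (l - k)

/-- The expectation of a function of the number of adversaries demanding one item and of the
per-item values. -/
noncomputable def mixture (l : ℕ) (q : ℝ) (X : ℕ → (Fin l → ℝ) → ℝ) : ℝ :=
  ∑ k ∈ Finset.range (l + 1), countWeight l q k * ∫ v, X k v ∂valueLaw l

section Mixture

variable {l : ℕ} {q : ℝ} {y : ℝ}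

theorem countWeight_nonneg (hq : q ∈ Set.Icc (0 : ℝ) 1) (k : ℕ) : 0 ≤ countWeight l q k :=
  mul_nonneg (mul_nonneg (Nat.cast_nonneg _) (pow_nonneg hq.1 _))
    (pow_nonneg (sub_nonneg.2 hq.2) _)

/-- The binomial theorem. It collapses the sum over k of the distribution functions into a single
power. -/
theorem sum_countWeight_mul (l : ℕ) (q s t : ℝ) :
    ∑ k ∈ Finset.range (l + 1), countWeight l q k * (s ^ k * t ^ (l - k)) =
      (q * s + (1 - q) * t) ^ l := by
  rw [add_pow]
  refine Finset.sum_congr rfl fun k _ => ?_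
  rw [countWeight, mul_pow, mul_pow]; ring

theorem sum_countWeight (l : ℕ) (q : ℝ) :
    ∑ k ∈ Finset.range (l + 1), countWeight l q k = 1 := by
  have := sum_countWeight_mul l q 1 1
  simpa using this

theorem countWeight_mul_succ {k : ℕ} (hk : k < l) :
    countWeight l q (k + 1) * (1 - q) * (k + 1) = countWeight l q k * q * (l - k : ℕ) := by
  have h : ((l.choose (k + 1) : ℕ) : ℝ) * (k + 1) = l.choose k * (l - k : ℕ) := by
    exact_mod_cast Nat.choose_succ_right_eq l k
  obtain ⟨m, rfl⟩ : ∃ m, l = k + 1 + m := ⟨l - (k + 1), by omega⟩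
  unfold countWeight
  rw [show k + 1 + m - (k + 1) = m by omega, show k + 1 + m - k = m + 1 by omega] at *
  linear_combination (q ^ (k + 1) * (1 - q) ^ (m + 1)) * h

/-- Compare term by term after a shift: the weighted gain at k is at most the weighted loss at k +
1. The factor (1-q)/q between consecutive weights is at most 1 here. -/
theorem mixture_gainAbove_le (hq : q ∈ Set.Icc (1 / 2 : ℝ) 1) (hy : y ∈ Set.Icc (0 : ℝ) 1) :
    mixture l q (fun k => gainAbove k y) ≤ mixture l q fun k => lossAbove k y := by
  have hq0 : q ∈ Set.Icc (0 : ℝ) 1 := ⟨by linarith [hq.1], hq.2⟩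
  unfold mixture
  -- The unmatched terms are harmless: the gain at k = l vanishes for lack of double bids, and the
  -- loss at k = 0 is nonnegative.
  rw [Finset.sum_range_succ, Finset.sum_range_succ']
  have h0 : ∫ v, gainAbove l y v ∂valueLaw l = 0 := by simp [gainAbove_self]
  have hL : ∀ k, 0 ≤ ∫ v, lossAbove k y v ∂valueLaw l := fun k =>
    integral_nonneg fun v => lossAbove_nonneg k v
  rw [h0, mul_zero]
  refine add_le_add (Finset.sum_le_sum fun k hk => ?_) (mul_nonneg (countWeight_nonneg hq0 _) (hL _))
  have hk := Finset.mem_range.1 hk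
  have h1 := integral_gainAbove_le hk hy
  have h2 := countWeight_mul_succ (q := q) hk
  have hm : (0 : ℝ) < (l - k : ℕ) := by exact_mod_cast Nat.sub_pos_of_lt hk
  have hw := countWeight_nonneg (l := l) hq0 k
  have hw' := countWeight_nonneg (l := l) hq0 (k + 1)
  set G := ∫ v, gainAbove k y v ∂valueLaw l
  set L := ∫ v, lossAbove (k + 1) y v ∂valueLaw l
  have hk1 : (0 : ℝ) < 2 * (k + 1) := by positivity
  have hLn : 0 ≤ L := hL _
  -- The weight identity with 1 - q ≤ q gives this even without the factor 2.
  have h3 : countWeight l q k * (l - k : ℕ) ≤ 2 * (k + 1) * countWeight l q (k + 1) := by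
    have h4 : 0 ≤ countWeight l q k * (l - k : ℕ) := mul_nonneg hw hm.le
    have h5 : 0 ≤ countWeight l q (k + 1) * (k + 1) := mul_nonneg hw' (by positivity)
    nlinarith [hq.1, hq.2]
  refine le_of_mul_le_mul_left ?_ hk1
  calc 2 * ((k : ℝ) + 1) * (countWeight l q k * G) = countWeight l q k * (2 * (k + 1) * G) := by ring
    _ ≤ countWeight l q k * ((l - k : ℕ) * L) := mul_le_mul_of_nonneg_left h1 hw
    _ = (countWeight l q k * (l - k : ℕ)) * L := by ring
    _ ≤ (2 * (k + 1) * countWeight l q (k + 1)) * L := mul_le_mul_of_nonneg_right h3 hLn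
    _ = _ := by ring

/-- Moves the average over k inside the layer cake integral, where `sum_countWeight_mul` applies. -/
theorem mixture_eq_integral {X : ℕ → (Fin l → ℝ) → ℝ} {P : ℕ → ℝ → ℝ} {c : ℝ}
    (hP : ∀ k, Continuous (P k)) (hX : ∀ k ≤ l, ∫ v, X k v ∂valueLaw l = ∫ u in 0..c, P k u) :
    mixture l q X = ∫ u in 0..c, ∑ k ∈ Finset.range (l + 1), countWeight l q k * P k u := by
  rw [intervalIntegral.integral_finsetSum
    fun k _ => ((hP k).const_mul _).intervalIntegrable _ _]
  refine Finset.sum_congr rfl fun k hk => ?_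
  rw [hX k (by simpa [Nat.lt_succ_iff] using hk), intervalIntegral.integral_const_mul]

theorem mixture_topSingle (hq : q ≠ 0) (hy : y ∈ Set.Icc (0 : ℝ) 1) :
    mixture l q (fun k => (valuesBelow k y).indicator (topSingle k)) =
      y ^ (l + 1) * (1 - (1 - (1 - q) ^ (l + 1)) / (q * (l + 1))) := by
  rw [mixture_eq_integral (P := fun k u => y ^ l - u ^ k * y ^ (l - k)) (c := y)
    (fun k => by fun_prop) fun k hk => integral_valuesBelow_topSingle hk hy]
  have : ∀ u, ∑ k ∈ Finset.range (l + 1), countWeight l q k * (y ^ l - u ^ k * y ^ (l - k)) =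
      y ^ l - (q * u + (1 - q) * y) ^ l := fun u => by
    simp only [mul_sub, Finset.sum_sub_distrib, ← Finset.sum_mul, sum_countWeight,
      sum_countWeight_mul, one_mul]
  simp only [this]
  rw [intervalIntegral.integral_sub (by simp)
    ((by fun_prop : Continuous fun u => (q * u + (1 - q) * y) ^ l).intervalIntegrable _ _),
    integral_linear_pow l hq]
  simp only [intervalIntegral.integral_const, smul_eq_mul, sub_zero, mul_zero, zero_add, mul_pow]
  have hl : (l : ℝ) + 1 ≠ 0 := by positivity
  rw [show q * y + (1 - q) * y = y by ring]
  field_simp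
  ring

theorem mixture_max (hq : 0 ≤ q) (hy : y ∈ Set.Icc (0 : ℝ) 1) :
    mixture l q (fun k => (valuesBelow k y).indicator
      fun v => max (topSingle k v) (2 * topDouble k v - y)) =
      y ^ (l + 1) * (1 - 2 * (1 - ((1 - q) / 2) ^ (l + 1)) / ((1 + q) * (l + 1))) := by
  rw [mixture_eq_integral (P := fun k u => y ^ l - u ^ k * ((u + y) / 2) ^ (l - k)) (c := y)
    (fun k => by fun_prop) fun k hk => integral_valuesBelow_max hk hy]
  have : ∀ u, ∑ k ∈ Finset.range (l + 1), countWeight l q k *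
      (y ^ l - u ^ k * ((u + y) / 2) ^ (l - k)) =
      y ^ l - ((1 + q) / 2 * u + (1 - q) / 2 * y) ^ l := fun u => by
    simp only [mul_sub, Finset.sum_sub_distrib, ← Finset.sum_mul, sum_countWeight,
      sum_countWeight_mul, one_mul]
    ring_nf
  simp only [this]
  have hq1 : (1 + q) / 2 ≠ 0 := by positivity
  rw [intervalIntegral.integral_sub (by simp)
    ((by fun_prop : Continuous fun u => ((1 + q) / 2 * u + (1 - q) / 2 * y) ^ l).intervalIntegrable
      _ _), integral_linear_pow l hq1]
  simp only [intervalIntegral.integral_const, smul_eq_mul, sub_zero, mul_zero, zero_add]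
  have hl : (l : ℝ) + 1 ≠ 0 := by positivity
  have hq2 : 1 + q ≠ 0 := by positivity
  rw [show (1 + q) / 2 * y + (1 - q) / 2 * y = y by ring, mul_pow ((1 - q) / 2)]
  field_simp
  ring

theorem mixture_advWelfare (hl : l ≠ 0) (hq : 0 ≤ q) (hy : y ∈ Set.Icc (0 : ℝ) 1) :
    mixture l q (fun k => (valuesBelow k y).indicator (advWelfare k)) =
      y ^ (l + 1) * (2 - 4 / (l + 1) + ((1 - q) / 2) ^ l / (l + 1) +
        2 * (1 - ((1 - q) / 2) ^ (l + 1)) / ((1 + q) * (l + 1))) := by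
  rw [mixture_eq_integral (c := 2 * y)
    (P := fun k u => y ^ l - (2 * (u / 2) ^ l - max 0 (u - y) ^ k * (u / 2) ^ (l - k)))
    (fun k => by fun_prop) fun k hk => integral_valuesBelow_advWelfare hl hk hy]
  have : ∀ u, ∑ k ∈ Finset.range (l + 1), countWeight l q k *
      (y ^ l - (2 * (u / 2) ^ l - max 0 (u - y) ^ k * (u / 2) ^ (l - k))) =
      y ^ l - 2 * (1 / 2 * u + 0) ^ l + (q * max 0 (u - y) + (1 - q) * (u / 2)) ^ l := fun u => by
    simp only [mul_sub, Finset.sum_sub_distrib, ← Finset.sum_mul, sum_countWeight,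
      sum_countWeight_mul, one_mul]
    ring_nf
  simp only [this]
  have c1 : Continuous fun u : ℝ => y ^ l - 2 * (1 / 2 * u + 0) ^ l := by fun_prop
  have c2 : Continuous fun u : ℝ => (q * max 0 (u - y) + (1 - q) * (u / 2)) ^ l := by fun_prop
  have c3 : Continuous fun u : ℝ => 2 * (1 / 2 * u + 0) ^ l := by fun_prop
  have hl1 : (l : ℝ) + 1 ≠ 0 := by positivity
  have hq2 : 1 + q ≠ 0 := by positivity
  have hq1 : (1 + q) / 2 ≠ 0 := by positivity
  -- The integrand has a kink at u = y; on either side of it the base of the power is linear.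
  have e1 : ∫ u in (0 : ℝ)..y, (q * max 0 (u - y) + (1 - q) * (u / 2)) ^ l =
      ((1 - q) / 2) ^ l * (y ^ (l + 1) / (l + 1)) := by
    rw [show y ^ (l + 1) / ((l : ℝ) + 1) = ∫ u in (0 : ℝ)..y, u ^ l by simp [integral_pow],
      ← intervalIntegral.integral_const_mul]
    refine intervalIntegral.integral_congr fun u hu => ?_
    rw [Set.uIcc_of_le hy.1] at hu
    rw [max_eq_left (by linarith [hu.2]), ← mul_pow]
    ring_nf
  have e2 : ∫ u in y..2 * y, (q * max 0 (u - y) + (1 - q) * (u / 2)) ^ l =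
      ∫ u in y..2 * y, ((1 + q) / 2 * u + (-q * y)) ^ l := by
    refine intervalIntegral.integral_congr fun u hu => ?_
    rw [Set.uIcc_of_le (by linarith [hy.1])] at hu
    rw [max_eq_right (by linarith [hu.1])]
    ring_nf
  rw [intervalIntegral.integral_add (c1.intervalIntegrable _ _) (c2.intervalIntegrable _ _),
    intervalIntegral.integral_sub (by simp) (c3.intervalIntegrable _ _),
    intervalIntegral.integral_const_mul, integral_linear_pow l (by norm_num : (1 / 2 : ℝ) ≠ 0),
    ← intervalIntegral.integral_add_adjacent_intervals (c2.intervalIntegrable 0 y)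
      (c2.intervalIntegrable y (2 * y)), e1, e2, integral_linear_pow l hq1,
    show (1 + q) / 2 * (2 * y) + -q * y = y by ring,
    show (1 + q) / 2 * y + -q * y = (1 - q) / 2 * y by ring, mul_pow,
    show 1 / 2 * (2 * y) + 0 = y by ring]
  simp only [intervalIntegral.integral_const, smul_eq_mul, sub_zero, mul_zero, add_zero, ne_eq,
    Nat.add_eq_zero_iff, one_ne_zero, and_false, not_false_eq_true, zero_pow]
  generalize ((1 - q) / 2) ^ l = A
  generalize ((1 - q) / 2) ^ (l + 1) = A'
  field_simp
  ring

end Mixture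

/-! ### Pointwise comparison of the attack with truth -/

/-- `u` is a possible utility of the attack `(1, x), (1, y)` for a bidder who values one item at
`T₁` and both at `T₂`, when the adversaries have maximal welfare `S` and highest single bid `a`. -/
def AttackOutcome (S a T₁ T₂ x y u : ℝ) : Prop :=
  (S ≤ x + y ∧ a ≤ x ∧ a ≤ y ∧ u = T₂ - max (S - y) a - max (S - x) a) ∨
  (y ≤ a ∧ S ≤ x + a ∧ u = T₁ - max (S - a) y) ∨
  (x ≤ a ∧ S ≤ y + a ∧ u = T₁ - max (S - a) x) ∨
  (x + a ≤ S ∧ y + a ≤ S ∧ x + y ≤ S ∧ u = 0)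

/-- Allows the assumption y ≤ x. The mechanism itself need not treat the two identities
symmetrically when it breaks ties, but the list of possible outcomes is symmetric. -/
theorem AttackOutcome.symm {S a T₁ T₂ x y u : ℝ} (h : AttackOutcome S a T₁ T₂ x y u) :
    AttackOutcome S a T₁ T₂ y x u := by
  rcases h with ⟨h1, h2, h3, h4⟩ | h | h | ⟨h1, h2, h3, h4⟩
  · exact Or.inl ⟨by linarith, h3, h2, by linarith⟩
  · exact Or.inr (Or.inr (Or.inl h))
  · exact Or.inr (Or.inl h)
  · exact Or.inr (Or.inr (Or.inr ⟨h2, h1, by linarith, h4⟩))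

section Utility

variable (M : VCG) {l : ℕ} (k : ℕ)

theorem attackOutcome_one (θ x y : ℝ) (v : Fin l → ℝ) :
    AttackOutcome (advWelfare k v) (topSingle k v) θ θ x y
      (M.utility (Demand.one, θ) (attack x y) (adversaries k v)) := by
  have := attack_cases M x y k v (Demand.one, θ)
  simpa only [AttackOutcome, Bid.total_one, if_true] using this

theorem attackOutcome_two (θ x y : ℝ) (v : Fin l → ℝ) :
    AttackOutcome (advWelfare k v) (topSingle k v) 0 (2 * θ) x y
      (M.utility (Demand.two, θ) (attack x y) (adversaries k v)) := by
  have := attack_cases M x y k v (Demand.two, θ)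
  simpa only [AttackOutcome, Bid.total_two, reduceCtorEq, if_false] using this

theorem measurable_adversaries : Measurable (adversaries k : (Fin l → ℝ) → Fin l → Bid) :=
  measurable_pi_iff.2 fun i => measurable_const.prodMk (measurable_pi_apply i)

theorem measurable_append_adversaries {m : ℕ} (own : Fin m → Bid) :
    Measurable fun v : Fin l → ℝ => Fin.append own (adversaries k v) := by
  refine measurable_pi_iff.2 fun i => ?_
  refine Fin.addCases (fun i => ?_) (fun i => ?_) i
  · simp only [Fin.append_left]
    exact measurable_const
  · simp only [Fin.append_right]
    exact (measurable_pi_apply i).comp (measurable_adversaries k)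

theorem measurableSet_mem_winners {m : ℕ} (own : Fin m → Bid) (b : Fin (m + l)) :
    MeasurableSet {v : Fin l → ℝ | b ∈ M.winners (Fin.append own (adversaries k v))} := by
  have : {v : Fin l → ℝ | b ∈ M.winners (Fin.append own (adversaries k v))} =
      ⋃ I ∈ {I : Finset (Fin (m + l)) | b ∈ I},
        (fun v : Fin l → ℝ => Fin.append own (adversaries k v)) ⁻¹' {B | M.winners B = I} := by
    ext v; simp
  rw [this]
  exact MeasurableSet.biUnion (Set.to_countable _) fun I _ =>
    measurable_append_adversaries k own (M.measurable_winners I)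

theorem measurable_utility_attack (t : Bid) (x y : ℝ) :
    Measurable fun v : Fin l → ℝ => M.utility t (attack x y) (adversaries k v) := by
  have h0 := measurableSet_mem_winners M (l := l) k (attack x y) (Fin.castAdd l 0)
  have h1 := measurableSet_mem_winners M (l := l) k (attack x y) (Fin.castAdd l 1)
  have hS := measurable_advWelfare (l := l) k
  have ha := measurable_topSingle (l := l) k
  -- With the welfare terms in closed form, the utility depends on the profile only through S, a and
  -- the events that each own bid wins.
  simp only [VCG.utility, VCG.itemsWon, VCG.payment, Fin.sum_univ_two, maxWelfare_attack_univ,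
    maxWelfare_attack_erase_zero, maxWelfare_attack_erase_one, Fin.append_left]
  refine Measurable.sub (Measurable.ite (measurableSet_le measurable_const ?_) measurable_const
    measurable_const) ?_
  · exact (Measurable.ite h0 measurable_const measurable_const).add
      (Measurable.ite h1 measurable_const measurable_const)
  · exact (Measurable.ite h0 (by fun_prop) measurable_const).add
      (Measurable.ite h1 (by fun_prop) measurable_const)

theorem ae_top_mem : ∀ᵐ v ∂valueLaw l, topSingle k v ≤ 1 ∧ topDouble k v ≤ 1 := by
  filter_upwards [ae_values_mem] with v hv
  exact ⟨(topSingle_le_iff k v 1).2 ⟨zero_le_one, fun i _ => (hv i).2⟩,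
    (topDouble_le_iff k v 1).2 ⟨zero_le_one, fun i _ => (hv i).2⟩⟩

/-- Positivity is essential: the maximum over an empty group is 0 with certainty, so y = 0 must be
treated apart later. -/
theorem ae_top_ne {y : ℝ} (hy : 0 < y) :
    ∀ᵐ v ∂valueLaw l, topSingle k v ≠ y ∧ topDouble k v ≠ y := by
  filter_upwards [ae_values_ne y] with v hv
  constructor
  · intro h
    refine absurd h (ne_of_lt ((Finset.fold_max_lt _).2 ⟨hy, fun i hi => lt_of_le_of_ne ?_ (hv i)⟩))
    exact ((topSingle_le_iff k v y).1 h.le).2 i (by simpa using hi)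
  · intro h
    refine absurd h (ne_of_lt ((Finset.fold_max_lt _).2 ⟨hy, fun i hi => lt_of_le_of_ne ?_ (hv i)⟩))
    exact ((topDouble_le_iff k v y).1 h.le).2 i (by simpa using hi)

theorem AttackOutcome.abs_le {S a T₁ T₂ x y u C : ℝ} (h : AttackOutcome S a T₁ T₂ x y u)
    (hS : S ∈ Set.Icc (0 : ℝ) 2) (ha : a ∈ Set.Icc (0 : ℝ) 1) (hx : x ∈ Set.Icc (0 : ℝ) 1)
    (hy : y ∈ Set.Icc (0 : ℝ) 1) (h1 : |T₁| ≤ C) (h2 : |T₂| ≤ C) : |u| ≤ C + 4 := by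
  obtain ⟨h1a, h1b⟩ := _root_.abs_le.1 h1
  obtain ⟨h2a, h2b⟩ := _root_.abs_le.1 h2
  obtain ⟨S0, S2⟩ := hS
  obtain ⟨a0, a1⟩ := ha
  obtain ⟨x0, x1⟩ := hx
  obtain ⟨y0, y1⟩ := hy
  have m1 : max (S - y) a ≤ 2 := max_le (by linarith) (by linarith)
  have m2 : max (S - x) a ≤ 2 := max_le (by linarith) (by linarith)
  have m3 : max (S - a) y ≤ 2 := max_le (by linarith) (by linarith)
  have m4 : max (S - a) x ≤ 2 := max_le (by linarith) (by linarith)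
  have n1 := le_max_right (S - y) a
  have n2 := le_max_right (S - x) a
  have n3 := le_max_right (S - a) y
  have n4 := le_max_right (S - a) x
  rw [_root_.abs_le]
  rcases h with ⟨-, -, -, h⟩ | ⟨-, -, h⟩ | ⟨-, -, h⟩ | ⟨-, -, -, h⟩ <;> constructor <;> linarith

theorem ae_welfare_mem : ∀ᵐ v ∂valueLaw l, advWelfare k v ∈ Set.Icc (0 : ℝ) 2 ∧
    topSingle k v ∈ Set.Icc (0 : ℝ) 1 := by
  filter_upwards [ae_top_mem k] with v hv
  exact ⟨⟨advWelfare_nonneg k v, (advWelfare_le_max k v).trans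
    (max_le (by linarith [hv.2]) (by linarith [hv.1]))⟩, topSingle_nonneg k v, hv.1⟩

variable {k} {θ x y : ℝ}

theorem integrable_utility_attack_one (hx : x ∈ Set.Icc (0 : ℝ) 1) (hy : y ∈ Set.Icc (0 : ℝ) 1) :
    Integrable (fun v => M.utility (Demand.one, θ) (attack x y) (adversaries k v)) (valueLaw l) :=
  Integrable.of_bound (measurable_utility_attack M k _ x y).aestronglyMeasurable (|θ| + 4) (by
    filter_upwards [ae_welfare_mem k] with v hv
    exact (attackOutcome_one M k θ x y v).abs_le hv.1 hv.2 hx hy le_rfl le_rfl)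

theorem integrable_utility_attack_two (hx : x ∈ Set.Icc (0 : ℝ) 1) (hy : y ∈ Set.Icc (0 : ℝ) 1) :
    Integrable (fun v => M.utility (Demand.two, θ) (attack x y) (adversaries k v)) (valueLaw l) :=
  Integrable.of_bound (measurable_utility_attack M k _ x y).aestronglyMeasurable (|2 * θ| + 4) (by
    filter_upwards [ae_welfare_mem k] with v hv
    exact (attackOutcome_two M k θ x y v).abs_le hv.1 hv.2 hx hy (by simp) le_rfl)

theorem integrable_utility_truth_one (hθ : 0 ≤ θ) : Integrable
    (fun v => M.utility (Demand.one, θ) (truth (Demand.one, θ)) (adversaries k v)) (valueLaw l) := by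
  have hS := measurable_advWelfare (l := l) k
  have ha := measurable_topSingle (l := l) k
  simp only [utility_truth_one]
  refine Integrable.of_bound (by fun_prop) θ (Filter.Eventually.of_forall fun v => ?_)
  rw [Real.norm_of_nonneg (le_max_left _ _)]
  exact max_le hθ (by linarith [topSingle_le_advWelfare k v])

theorem integrable_utility_truth_two (hθ : 0 ≤ θ) : Integrable
    (fun v => M.utility (Demand.two, θ) (truth (Demand.two, θ)) (adversaries k v)) (valueLaw l) := by
  have hS := measurable_advWelfare (l := l) k
  simp only [utility_truth_two]
  refine Integrable.of_bound (by fun_prop) (2 * θ) (Filter.Eventually.of_forall fun v => ?_)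
  rw [Real.norm_of_nonneg (le_max_left _ _)]
  exact max_le (by linarith) (by linarith [advWelfare_nonneg k v])

theorem integrable_valuesBelow_topSingle (hy : 0 ≤ y) :
    Integrable ((valuesBelow k y).indicator (topSingle k)) (valueLaw l) :=
  integrable_indicator_of_le _ measurableSet_valuesBelow (measurable_topSingle k) hy
    (fun v _ => topSingle_nonneg k v) fun _ hv => hv.1

theorem integrable_valuesBelow_advWelfare (hy : 0 ≤ y) :
    Integrable ((valuesBelow k y).indicator (advWelfare k)) (valueLaw l) :=
  integrable_indicator_of_le _ measurableSet_valuesBelow (measurable_advWelfare k)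
    (by linarith : 0 ≤ 2 * y) (fun v _ => advWelfare_nonneg k v) fun v hv =>
      (advWelfare_le_max k v).trans (max_le (by linarith [hv.2]) (by linarith [hv.1]))

theorem integrable_valuesBelow_max (hy : 0 ≤ y) :
    Integrable ((valuesBelow k y).indicator
      fun v => max (topSingle k v) (2 * topDouble k v - y)) (valueLaw l) :=
  integrable_indicator_of_le _ measurableSet_valuesBelow
    ((measurable_topSingle k).max (((measurable_topDouble k).const_mul 2).sub_const y)) hy
    (fun v _ => le_max_of_le_left (topSingle_nonneg k v))
    fun v hv => max_le hv.1 (by linarith [hv.2])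

/-- Three regimes, separated by the position of y: a and b below it (both bids win, each price at
least a); a below and b above it (a possible gain); a above it (the lower bid only raises the
price). Excluding equality leaves no ambiguous ties between the regimes. -/
theorem AttackOutcome.le_one {v : Fin l → ℝ} {u : ℝ}
    (h : AttackOutcome (advWelfare k v) (topSingle k v) θ θ x y u) (hyx : y ≤ x)
    (hx : x ≤ 1) (h1 : topSingle k v ≠ y) (h2 : topDouble k v ≠ y) :
    u ≤ max 0 (θ + topSingle k v - advWelfare k v) +
      (valuesBelow k y).indicator (advWelfare k) v -
      3 * (valuesBelow k y).indicator (topSingle k) v + gainAbove k y v - lossAbove k y v := by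
  have a0 := topSingle_nonneg k v
  have b0 := topDouble_nonneg k v
  have S1 := topSingle_le_advWelfare k v
  have S2 := two_mul_topDouble_le_advWelfare k v
  have S3 := advWelfare_le_max k v
  have hG : 0 ≤ gainAbove k y v := Set.indicator_nonneg (fun _ _ => le_max_left _ _) v
  have t0 := le_max_left 0 (θ + topSingle k v - advWelfare k v)
  have t1 := le_max_right 0 (θ + topSingle k v - advWelfare k v)
  rcases lt_or_gt_of_ne h1 with ha | ha
  · have hL : lossAbove k y v = 0 := Set.indicator_of_notMem
      (show v ∉ {v | y < topSingle k v} from not_lt.2 ha.le) _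
    rw [hL]
    rcases lt_or_gt_of_ne h2 with hb | hb
    · have hB : v ∈ valuesBelow k y := ⟨ha.le, hb.le⟩
      rw [Set.indicator_of_mem hB, Set.indicator_of_mem hB]
      rcases h with ⟨-, -, -, rfl⟩ | ⟨h, -⟩ | ⟨h, -⟩ | ⟨-, -, h, -⟩
      · linarith [le_max_right (advWelfare k v - y) (topSingle k v),
          le_max_right (advWelfare k v - x) (topSingle k v)]
      · linarith
      · linarith
      · have := max_lt (by linarith : 2 * topDouble k v < 2 * y)
          (by linarith : 2 * topSingle k v < 2 * y)
        linarith
    · have hB : v ∉ valuesBelow k y := fun h => by linarith [h.2]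
      rw [Set.indicator_of_notMem hB, Set.indicator_of_notMem hB]
      have hG' : y - max (topSingle k v) (2 * topDouble k v - 1) ≤ gainAbove k y v := by
        rw [gainAbove, Set.indicator_of_mem (show v ∈ {v | y ≤ topDouble k v} from hb.le)]
        exact le_max_right _ _
      -- Here a < y < b, so S = 2b.
      rw [max_eq_left (by linarith)] at S3
      rcases h with ⟨-, -, -, rfl⟩ | ⟨h, -⟩ | ⟨h, -⟩ | ⟨-, -, -, rfl⟩
      · have := max_le_max (le_refl (topSingle k v))
          (by linarith : 2 * topDouble k v - 1 ≤ advWelfare k v - x)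
        rw [max_comm (topSingle k v) (advWelfare k v - x)] at this
        linarith [le_max_left (advWelfare k v - y) (topSingle k v)]
      · linarith
      · linarith
      · linarith
  · have hB : v ∉ valuesBelow k y := fun h => by linarith [h.1]
    rw [Set.indicator_of_notMem hB, Set.indicator_of_notMem hB]
    have hL : lossAbove k y v = max 0 (y - (advWelfare k v - topSingle k v)) :=
      Set.indicator_of_mem (show v ∈ {v | y < topSingle k v} from ha) _
    -- The second bid raises the price from S - a to max(S - a, y), and the increase is exactly the
    -- loss.
    have key : max (advWelfare k v - topSingle k v) y -
        max 0 (y - (advWelfare k v - topSingle k v)) = advWelfare k v - topSingle k v := by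
      rcases le_total (advWelfare k v - topSingle k v) y with h | h
      · rw [max_eq_right h, max_eq_right (by linarith)]; ring
      · rw [max_eq_left h, max_eq_left (by linarith)]; ring
    rw [hL]
    rcases h with ⟨-, -, h, -⟩ | ⟨-, -, rfl⟩ | ⟨-, -, rfl⟩ | ⟨h, -, -, rfl⟩
    · linarith
    · linarith
    · linarith [max_le_max (le_refl (advWelfare k v - topSingle k v)) hyx]
    · rw [max_eq_left (by linarith : y - (advWelfare k v - topSingle k v) ≤ 0)]
      linarith

theorem AttackOutcome.le_one_of_zero {S a u : ℝ} (h : AttackOutcome S a θ θ x 0 u) (ha : 0 ≤ a) :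
    u ≤ max 0 (θ + a - S) := by
  have t0 := le_max_left 0 (θ + a - S)
  have t1 := le_max_right 0 (θ + a - S)
  rcases h with ⟨-, -, -, rfl⟩ | ⟨-, -, rfl⟩ | ⟨-, -, rfl⟩ | ⟨-, -, -, rfl⟩
  · linarith [le_max_left (S - 0) a, le_max_right (S - x) a]
  · linarith [le_max_left (S - a) 0]
  · linarith [le_max_left (S - a) x]
  · exact t0

/-- The attacker earns something only if both bids win, which forces a ≤ θ and 2b ≤ S ≤ 2θ. Each
price max(S - θ, a) is then at least max(a, 2b - θ), and truth earns 2θ - S. In all other outcomes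
the attack earns at most zero. -/
theorem AttackOutcome.le_two {v : Fin l → ℝ} {u : ℝ}
    (h : AttackOutcome (advWelfare k v) (topSingle k v) 0 (2 * θ) θ θ u) (hθ : 0 ≤ θ)
    (h1 : topSingle k v ≠ θ) (h2 : topDouble k v ≠ θ) :
    u ≤ max 0 (2 * θ - advWelfare k v) + (valuesBelow k θ).indicator (advWelfare k) v -
      2 * (valuesBelow k θ).indicator
        (fun v => max (topSingle k v) (2 * topDouble k v - θ)) v := by
  have S2 := two_mul_topDouble_le_advWelfare k v
  have S3 := advWelfare_le_max k v
  have t0 := le_max_left 0 (2 * θ - advWelfare k v)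
  have t1 := le_max_right 0 (2 * θ - advWelfare k v)
  rcases h with ⟨h3, h4, -, rfl⟩ | ⟨h, -, rfl⟩ | ⟨h, -, rfl⟩ | ⟨-, -, h, rfl⟩
  · have hB : v ∈ valuesBelow k θ := ⟨h4, by linarith⟩
    rw [Set.indicator_of_mem hB, Set.indicator_of_mem hB]
    have := max_le_max (le_refl (topSingle k v))
      (by linarith : 2 * topDouble k v - θ ≤ advWelfare k v - θ)
    rw [max_comm (topSingle k v) (advWelfare k v - θ)] at this
    linarith
  · have hB : v ∉ valuesBelow k θ := fun hv => h1 (le_antisymm hv.1 h)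
    rw [Set.indicator_of_notMem hB, Set.indicator_of_notMem hB]
    linarith [le_max_right (advWelfare k v - topSingle k v) θ]
  · have hB : v ∉ valuesBelow k θ := fun hv => h1 (le_antisymm hv.1 h)
    rw [Set.indicator_of_notMem hB, Set.indicator_of_notMem hB]
    linarith [le_max_right (advWelfare k v - topSingle k v) θ]
  · have hB : v ∉ valuesBelow k θ := fun hv => by
      have := max_lt (by linarith [lt_of_le_of_ne hv.2 h2] : 2 * topDouble k v < 2 * θ)
        (by linarith [lt_of_le_of_ne hv.1 h1] : 2 * topSingle k v < 2 * θ)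
      linarith
    rw [Set.indicator_of_notMem hB, Set.indicator_of_notMem hB]
    linarith

/-- Below θ the bound of `AttackOutcome.le_two` is attained, since S ≤ max(2a, 2b) makes each price
at most max(a, 2b - θ). For θ = 1 this covers almost every profile. -/
theorem AttackOutcome.ge_two {v : Fin l → ℝ} {u : ℝ}
    (h : AttackOutcome (advWelfare k v) (topSingle k v) 0 (2 * θ) θ θ u)
    (h1 : topSingle k v < θ) (h2 : topDouble k v < θ) :
    max 0 (2 * θ - advWelfare k v) + (valuesBelow k θ).indicator (advWelfare k) v -
      2 * (valuesBelow k θ).indicator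
        (fun v => max (topSingle k v) (2 * topDouble k v - θ)) v ≤ u := by
  have S3 := advWelfare_le_max k v
  have S4 := max_lt (by linarith : 2 * topDouble k v < 2 * θ)
    (by linarith : 2 * topSingle k v < 2 * θ)
  have hB : v ∈ valuesBelow k θ := ⟨h1.le, h2.le⟩
  rw [Set.indicator_of_mem hB, Set.indicator_of_mem hB, max_eq_right (by linarith)]
  rcases h with ⟨-, -, -, rfl⟩ | ⟨h, -⟩ | ⟨h, -⟩ | ⟨-, -, h, -⟩
  · have n1 := le_max_left (topSingle k v) (2 * topDouble k v - θ)
    have n2 := le_max_right (topSingle k v) (2 * topDouble k v - θ)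
    have : advWelfare k v - θ ≤ max (topSingle k v) (2 * topDouble k v - θ) := by
      rcases le_max_iff.1 S3 with h | h <;> linarith
    linarith [max_le this n1]
  all_goals linarith

end Utility

/-! ### Expected utilities and the threshold 1/2 -/

section Threshold

variable (M : VCG) {l : ℕ} {q θ x y : ℝ}

theorem expectedUtility_eq_mixture (l : ℕ) (q : ℝ) (t : Bid) {m : ℕ} (own : Fin m → Bid) :
    M.expectedUtility uniform (l + 1) q t own =
      mixture l q fun k v => M.utility t own (adversaries k v) := rfl

theorem mixture_mono (hq : q ∈ Set.Icc (0 : ℝ) 1) {X Y : ℕ → (Fin l → ℝ) → ℝ}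
    (h : ∀ k, ∫ v, X k v ∂valueLaw l ≤ ∫ v, Y k v ∂valueLaw l) : mixture l q X ≤ mixture l q Y :=
  Finset.sum_le_sum fun k _ => mul_le_mul_of_nonneg_left (h k) (countWeight_nonneg hq k)

theorem mixture_add {X Y : ℕ → (Fin l → ℝ) → ℝ} (hX : ∀ k, Integrable (X k) (valueLaw l))
    (hY : ∀ k, Integrable (Y k) (valueLaw l)) :
    mixture l q (fun k v => X k v + Y k v) = mixture l q X + mixture l q Y := by
  simp only [mixture, integral_add (hX _) (hY _), mul_add, Finset.sum_add_distrib]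

theorem mixture_sub {X Y : ℕ → (Fin l → ℝ) → ℝ} (hX : ∀ k, Integrable (X k) (valueLaw l))
    (hY : ∀ k, Integrable (Y k) (valueLaw l)) :
    mixture l q (fun k v => X k v - Y k v) = mixture l q X - mixture l q Y := by
  simp only [mixture, integral_sub (hX _) (hY _), mul_sub, Finset.sum_sub_distrib]

theorem mixture_const_mul (c : ℝ) (X : ℕ → (Fin l → ℝ) → ℝ) :
    mixture l q (fun k v => c * X k v) = c * mixture l q X := by
  simp only [mixture, integral_const_mul, Finset.mul_sum]
  exact Finset.sum_congr rfl fun k _ => by ring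

/-- The comparison of S with 3a below y, after cancelling y^(l+1). After multiplication by l + 1 it
follows from the three bounds 1/16, 4/3 and l + 13/4, whose sum is below l + 5. This is the only
step that asks for l ≥ 2 rather than l ≠ 0. -/
theorem advWelfare_coeff_le_three_mul_topSingle_coeff (hl : 2 ≤ l) (hq : q ∈ Set.Icc (1 / 2 : ℝ) 1) :
    2 - 4 / (l + 1) + ((1 - q) / 2) ^ l / (l + 1) +
        2 * (1 - ((1 - q) / 2) ^ (l + 1)) / ((1 + q) * (l + 1)) ≤
      3 * (1 - (1 - (1 - q) ^ (l + 1)) / (q * (l + 1))) := by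
  obtain ⟨hq1, hq2⟩ := hq
  have hq0 : 0 < q := by linarith
  have hl2 : (2 : ℝ) ≤ l := by exact_mod_cast hl
  have hl1 : (0 : ℝ) < l + 1 := by positivity
  have hA0 : 0 ≤ (1 - q) / 2 := by linarith
  have hA : ((1 - q) / 2) ^ l ≤ 1 / 16 := by
    calc ((1 - q) / 2) ^ l ≤ (1 / 4) ^ l := pow_le_pow_left₀ hA0 (by linarith) _
      _ ≤ (1 / 4) ^ 2 := pow_le_pow_of_le_one (by norm_num) (by norm_num) hl
      _ = 1 / 16 := by norm_num
  have hB : 2 * (1 - ((1 - q) / 2) ^ (l + 1)) / (1 + q) ≤ 4 / 3 := by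
    rw [div_le_iff₀ (by linarith)]
    linarith [pow_nonneg hA0 (l + 1)]
  -- For l = 2 the left side is 3(3 - 3q + q²), and 13/4 makes this an equality at q = 1/2. For l ≥
  -- 3 the bound 3/q ≤ 6 suffices.
  have hC : 3 * (1 - (1 - q) ^ (l + 1)) / q ≤ l + 13 / 4 := by
    rcases hl.eq_or_lt with rfl | h
    · rw [div_le_iff₀ hq0]
      norm_num
      nlinarith [mul_nonneg (sub_nonneg.2 hq2) (sub_nonneg.2 hq1), sq_nonneg (1 - q)]
    · have hl3 : (3 : ℝ) ≤ l := by exact_mod_cast h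
      rw [div_le_iff₀ hq0]
      nlinarith [pow_nonneg (sub_nonneg.2 hq2) (l + 1)]
  rw [← sub_nonneg]
  have e : 3 * (1 - (1 - (1 - q) ^ (l + 1)) / (q * (l + 1))) - (2 - 4 / (l + 1) +
      ((1 - q) / 2) ^ l / (l + 1) + 2 * (1 - ((1 - q) / 2) ^ (l + 1)) / ((1 + q) * (l + 1))) =
      (l + 5 - ((1 - q) / 2) ^ l - 2 * (1 - ((1 - q) / 2) ^ (l + 1)) / (1 + q) -
        3 * (1 - (1 - q) ^ (l + 1)) / q) / (l + 1) := by
    have : 1 + q ≠ 0 := by positivity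
    generalize ((1 - q) / 2) ^ l = A
    generalize ((1 - q) / 2) ^ (l + 1) = B
    generalize (1 - q) ^ (l + 1) = C
    field_simp
    ring
  rw [e]
  exact div_nonneg (by linarith) hl1.le

/-- A bidder with demand one does not gain from the attack `(1, x), (1, y)`. -/
theorem mixture_le_of_attackOutcome_one (hl : 2 ≤ l) (hq : q ∈ Set.Icc (1 / 2 : ℝ) 1)
    (hθ : 0 ≤ θ) (hy : 0 ≤ y) (hyx : y ≤ x) (hx : x ≤ 1) {u : ℕ → (Fin l → ℝ) → ℝ}
    (hu : ∀ k, Integrable (u k) (valueLaw l))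
    (h : ∀ k v, AttackOutcome (advWelfare k v) (topSingle k v) θ θ x y (u k v)) :
    mixture l q u ≤ mixture l q fun k v =>
      M.utility (Demand.one, θ) (truth (Demand.one, θ)) (adversaries k v) := by
  have hq0 : q ∈ Set.Icc (0 : ℝ) 1 := ⟨by linarith [hq.1], hq.2⟩
  have hT := fun k => integrable_utility_truth_one M (l := l) (k := k) hθ
  -- A zero second bid never helps, profile by profile; this settles the value of y at which a and b
  -- may have an atom.
  rcases hy.eq_or_lt with rfl | hy0
  · refine mixture_mono hq0 fun k => integral_mono (hu k) (hT k) fun v => ?_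
    simp only [utility_truth_one]
    exact (h k v).le_one_of_zero (topSingle_nonneg k v)
  · have hy1 : y ∈ Set.Icc (0 : ℝ) 1 := ⟨hy, hyx.trans hx⟩
    have hS := fun k => integrable_valuesBelow_advWelfare (l := l) (k := k) hy
    have ha := fun k => (integrable_valuesBelow_topSingle (l := l) (k := k) hy).const_mul 3
    have hG := fun k => integrable_gainAbove (l := l) k hy
    have hL := fun k => integrable_lossAbove (l := l) k hy
    have h1 : ∀ k, Integrable (fun v => M.utility (Demand.one, θ) (truth (Demand.one, θ))
        (adversaries k v) + (valuesBelow k y).indicator (advWelfare k) v) (valueLaw l) :=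
      fun k => (hT k).add (hS k)
    have h2 : ∀ k, Integrable (fun v => M.utility (Demand.one, θ) (truth (Demand.one, θ))
        (adversaries k v) + (valuesBelow k y).indicator (advWelfare k) v -
        3 * (valuesBelow k y).indicator (topSingle k) v) (valueLaw l) :=
      fun k => (h1 k).sub (ha k)
    have h3 : ∀ k, Integrable (fun v => M.utility (Demand.one, θ) (truth (Demand.one, θ))
        (adversaries k v) + (valuesBelow k y).indicator (advWelfare k) v -
        3 * (valuesBelow k y).indicator (topSingle k) v + gainAbove k y v) (valueLaw l) :=
      fun k => (h2 k).add (hG k)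
    calc mixture l q u ≤ mixture l q fun k v =>
          M.utility (Demand.one, θ) (truth (Demand.one, θ)) (adversaries k v) +
          (valuesBelow k y).indicator (advWelfare k) v -
          3 * (valuesBelow k y).indicator (topSingle k) v + gainAbove k y v - lossAbove k y v := by
          refine mixture_mono hq0 fun k => integral_mono_ae (hu k)
            ((h3 k).sub (hL k)) ?_
          filter_upwards [ae_top_ne k hy0] with v hv
          simp only [utility_truth_one]
          exact (h k v).le_one hyx hx hv.1 hv.2
      _ = mixture l q (fun k v =>
            M.utility (Demand.one, θ) (truth (Demand.one, θ)) (adversaries k v)) +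
          mixture l q (fun k => (valuesBelow k y).indicator (advWelfare k)) -
          3 * mixture l q (fun k => (valuesBelow k y).indicator (topSingle k)) +
          mixture l q (fun k => gainAbove k y) - mixture l q (fun k => lossAbove k y) := by
          rw [mixture_sub h3 hL, mixture_add h2 hG, mixture_sub h1 ha, mixture_add hT hS,
            mixture_const_mul]
      _ ≤ _ := by
          have h1 := mixture_gainAbove_le (l := l) hq hy1
          rw [mixture_advWelfare (by omega) hq0.1 hy1, mixture_topSingle (by linarith [hq.1]) hy1]
          have h2 := mul_le_mul_of_nonneg_left
            (advWelfare_coeff_le_three_mul_topSingle_coeff hl hq) (pow_nonneg hy (l + 1))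
          linarith

theorem truthBeats_one (hl : 2 ≤ l) (hq : q ∈ Set.Icc (1 / 2 : ℝ) 1) (hθ : 0 ≤ θ)
    (hx : x ∈ Set.Icc (0 : ℝ) 1) (hy : y ∈ Set.Icc (0 : ℝ) 1) :
    M.TruthBeats uniform (l + 1) Demand.one θ x y q := by
  rw [VCG.TruthBeats, expectedUtility_eq_mixture, expectedUtility_eq_mixture]
  have hu := fun k => integrable_utility_attack_one M (l := l) (k := k) (θ := θ) hx hy
  rcases le_total y x with h | h
  · exact mixture_le_of_attackOutcome_one M hl hq hθ hy.1 h hx.2 hu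
      fun k v => attackOutcome_one M k θ x y v
  · exact mixture_le_of_attackOutcome_one M hl hq hθ hx.1 h hy.2 hu
      fun k v => (attackOutcome_one M k θ x y v).symm

/-- A bound, sharp for `θ = 1`, for the expected gain by the split attack `(1, θ), (1, θ)` over
truthful bidding for a bidder with demand two and value `θ`. -/
noncomputable def splitGain (l : ℕ) (θ q : ℝ) : ℝ :=
  2 * θ ^ (l + 1) * (1 - 2 * q) * (1 - ((1 - q) / 2) ^ l) / ((l + 1) * (1 + q))

/-- Subtracting twice the coefficient of `mixture_max` from that of `mixture_advWelfare` cancels the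
leading 2, and what remains factors through 1 - 2q. -/
theorem mixture_splitGain (hl : l ≠ 0) (hq : 0 ≤ q) (hθ : θ ∈ Set.Icc (0 : ℝ) 1) :
    mixture l q (fun k v =>
      M.utility (Demand.two, θ) (truth (Demand.two, θ)) (adversaries k v) +
      (valuesBelow k θ).indicator (advWelfare k) v - 2 * (valuesBelow k θ).indicator
        (fun v => max (topSingle k v) (2 * topDouble k v - θ)) v) =
    mixture l q (fun k v =>
      M.utility (Demand.two, θ) (truth (Demand.two, θ)) (adversaries k v)) +
      splitGain l θ q := by
  have hT := fun k => integrable_utility_truth_two M (l := l) (k := k) hθ.1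
  have hS := fun k => integrable_valuesBelow_advWelfare (l := l) (k := k) hθ.1
  have ha := fun k => (integrable_valuesBelow_max (l := l) (k := k) hθ.1).const_mul 2
  have hTS : ∀ k, Integrable (fun v => M.utility (Demand.two, θ) (truth (Demand.two, θ))
      (adversaries k v) + (valuesBelow k θ).indicator (advWelfare k) v) (valueLaw l) :=
    fun k => (hT k).add (hS k)
  rw [mixture_sub hTS ha, mixture_add hT hS, mixture_const_mul,
    mixture_advWelfare hl hq hθ, mixture_max hq hθ, splitGain, add_sub_assoc]
  congr 1
  have h1 : 1 + q ≠ 0 := by positivity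
  have h2 : (l : ℝ) + 1 ≠ 0 := by positivity
  rw [pow_succ ((1 - q) / 2) l]
  generalize ((1 - q) / 2) ^ l = A
  field_simp
  ring

theorem splitGain_nonpos (hq : q ∈ Set.Icc (1 / 2 : ℝ) 1) (hθ : 0 ≤ θ) : splitGain l θ q ≤ 0 := by
  have h1 : ((1 - q) / 2) ^ l ≤ 1 := pow_le_one₀ (by linarith [hq.2]) (by linarith [hq.1])
  have hq0 : 0 ≤ q := by linarith [hq.1]
  refine div_nonpos_of_nonpos_of_nonneg (mul_nonpos_of_nonpos_of_nonneg
    (mul_nonpos_of_nonneg_of_nonpos (by positivity) (by linarith [hq.1])) (by linarith))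
    (by positivity)

theorem splitGain_pos (hl : l ≠ 0) (hq : q ∈ Set.Ioo (0 : ℝ) (1 / 2)) : 0 < splitGain l 1 q := by
  have h1 : ((1 - q) / 2) ^ l < 1 :=
    pow_lt_one₀ (by linarith [hq.2]) (by linarith [hq.1]) hl
  have hq0 := hq.1
  have h2 : 0 < 1 - 2 * q := by linarith [hq.2]
  have h3 : 0 < 1 - ((1 - q) / 2) ^ l := by linarith
  unfold splitGain
  positivity

theorem truthBeats_two (hl : l ≠ 0) (hq : q ∈ Set.Icc (1 / 2 : ℝ) 1) (hθ : θ ∈ Set.Icc (0 : ℝ) 1) :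
    M.TruthBeats uniform (l + 1) Demand.two θ θ θ q := by
  rw [VCG.TruthBeats, expectedUtility_eq_mixture, expectedUtility_eq_mixture]
  have hq0 : q ∈ Set.Icc (0 : ℝ) 1 := ⟨by linarith [hq.1], hq.2⟩
  have hu := fun k => integrable_utility_attack_two M (l := l) (k := k) (θ := θ) hθ hθ
  have hT := fun k => integrable_utility_truth_two M (l := l) (k := k) hθ.1
  rcases hθ.1.eq_or_lt with rfl | h0
  · refine mixture_mono hq0 fun k => integral_mono (hu k) (hT k) fun v => ?_
    simp only [utility_truth_two]
    refine le_trans ?_ (le_max_left _ _)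
    have a0 := topSingle_nonneg k v
    rcases attackOutcome_two M k 0 0 0 v with ⟨-, -, -, h⟩ | ⟨-, -, h⟩ | ⟨-, -, h⟩ | ⟨-, -, -, h⟩
    · linarith [le_max_right (advWelfare k v - 0) (topSingle k v)]
    · linarith [le_max_right (advWelfare k v - topSingle k v) 0]
    · linarith [le_max_right (advWelfare k v - topSingle k v) 0]
    · exact h.le
  · have hS := fun k => integrable_valuesBelow_advWelfare (l := l) (k := k) hθ.1
    have ha := fun k => (integrable_valuesBelow_max (l := l) (k := k) hθ.1).const_mul 2
    refine le_trans (mixture_mono hq0 fun k => integral_mono_ae (hu k)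
      (((hT k).add (hS k)).sub (ha k)) ?_) ((mixture_splitGain M hl hq0.1 hθ).le.trans ?_)
    · filter_upwards [ae_top_ne k h0] with v hv
      have := (attackOutcome_two M k θ θ θ v).le_two hθ.1 hv.1 hv.2
      rw [← utility_truth_two M k v] at this
      exact this
    · linarith [splitGain_nonpos (l := l) hq hθ.1]

theorem not_truthBeats_two (hl : l ≠ 0) (hq : q ∈ Set.Ioo (0 : ℝ) (1 / 2)) :
    ¬ M.TruthBeats uniform (l + 1) Demand.two 1 1 1 q := by
  rw [VCG.TruthBeats, expectedUtility_eq_mixture, expectedUtility_eq_mixture, not_le]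
  have hq0 : q ∈ Set.Icc (0 : ℝ) 1 := ⟨hq.1.le, by linarith [hq.2]⟩
  have h1 : (1 : ℝ) ∈ Set.Icc (0 : ℝ) 1 := by simp
  have hu := fun k => integrable_utility_attack_two M (l := l) (k := k) (θ := 1) h1 h1
  have hT := fun k => integrable_utility_truth_two M (l := l) (k := k) h1.1
  have hS := fun k => integrable_valuesBelow_advWelfare (l := l) (k := k) h1.1
  have ha := fun k => (integrable_valuesBelow_max (l := l) (k := k) h1.1).const_mul 2
  refine lt_of_lt_of_le ?_ ((mixture_splitGain M hl hq0.1 h1).ge.trans (mixture_mono hq0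
    fun k => integral_mono_ae (((hT k).add (hS k)).sub (ha k)) (hu k) ?_))
  · linarith [splitGain_pos hl hq]
  · filter_upwards [ae_top_ne k one_pos, ae_top_mem k] with v hv hv1
    have := (attackOutcome_two M k 1 1 1 v).ge_two (lt_of_le_of_ne hv1.1 hv.1)
      (lt_of_le_of_ne hv1.2 hv.2)
    rw [← utility_truth_two M k v] at this
    exact this

end Threshold

theorem leastThreshold_le {P : ℝ → Prop} {p : ℝ} (hp : p ∈ Set.Icc (0 : ℝ) 1)
    (h : ∀ q ∈ Set.Ioc p 1, P q) : leastThreshold P ≤ p :=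
  (isLeast_leastThreshold P).2 ⟨hp, h⟩

end VCGAuction

theorem mainTheorem6 (M : VCGAuction.VCG) (n : ℕ) (hn : 3 ≤ n) :
    VCGAuction.granularityThresholdOfDemand M VCGAuction.uniform n VCGAuction.Demand.one ≤ 1 / 2 ∧
    (∀ θ ∈ Set.Icc (0 : ℝ) 1,
      VCGAuction.granularityThreshold M VCGAuction.uniform n VCGAuction.Demand.two θ θ θ ≤ 1 / 2) ∧
    VCGAuction.granularityThreshold M VCGAuction.uniform n VCGAuction.Demand.two 1 1 1 = 1 / 2 := by
  obtain ⟨l, rfl⟩ : ∃ l, n = l + 1 := ⟨n - 1, by omega⟩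
  have hl : l ≠ 0 := by omega
  have hhalf : (1 / 2 : ℝ) ∈ Set.Icc (0 : ℝ) 1 := by norm_num
  have htwo : ∀ θ ∈ Set.Icc (0 : ℝ) 1, VCGAuction.granularityThreshold M VCGAuction.uniform (l + 1)
      VCGAuction.Demand.two θ θ θ ≤ 1 / 2 := fun θ hθ =>
    VCGAuction.leastThreshold_le hhalf fun q hq =>
      VCGAuction.truthBeats_two M hl ⟨hq.1.le, hq.2⟩ hθ
  refine ⟨VCGAuction.leastThreshold_le hhalf fun q hq θ hθ x hx y hy =>
    VCGAuction.truthBeats_one M (by omega) ⟨hq.1.le, hq.2⟩ hθ.1 hx hy, htwo,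
    le_antisymm (htwo 1 (by simp)) ?_⟩
  obtain ⟨⟨h0, -⟩, hP⟩ := (VCGAuction.isLeast_leastThreshold fun q =>
    M.TruthBeats VCGAuction.uniform (l + 1) VCGAuction.Demand.two 1 1 1 q).1
  rw [VCGAuction.granularityThreshold]
  set p := VCGAuction.leastThreshold fun q =>
    M.TruthBeats VCGAuction.uniform (l + 1) VCGAuction.Demand.two 1 1 1 q
  by_contra! hlt
  -- The midpoint of p and 1/2 lies in (0, 1/2), where truth fails, and above p, where it would have
  -- to win.
  exact VCGAuction.not_truthBeats_two M hl (q := (p + 1 / 2) / 2) ⟨by linarith, by linarith⟩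
    (hP _ ⟨by linarith, by linarith⟩)
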